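/- All groups are abelian. A subgroup $B$ of a torsion-free group $G$ is called basic in $G$ if $B$ is free, $B$ is pure in $G$, and $G/B$ is divisible. A group is $\aleph_1$-free if all its countable subgroups are free, and $\aleph_1$-separable if each of its countable subsets is contained in a countable free direct summand. An $\omega_1$-filtration of a group $G$ is an increasing chain $(G_\nu)_{\nu<\omega_1}$ of countable subgroups with union $G$ such that $G_\lambda=\bigcup_{\nu<\lambda}G_\nu$ for all limit ordinals $\lambda<\omega_1$. For a group $G$ of cardinality $\aleph_1$, the Gamma invariant $\Gamma(G)\in\mathcal P(\omega_1)/NS$ (subsets of $\omega_1$ modulo non-stationary sets) is the class of $\{\nu<\omega_1 : G/G_\nu \text{ is not } \aleph_1\text{-free}\}$, for any $\omega_1$-filtration $(G_\nu)$ of $G$; it does not depend on the filtration. Theorem. (1) There exist an $\aleph_1$-separable torsion-free group $G$ of cardinality $\aleph_1$ and a basic subgroup $B$ of $G$ of rank $\aleph_1$ such that every subgroup $H$ of $G$ with $H\cap B=0$ is free, but $G$ itself is not free. (2) Moreover, for every non-zero element $\gamma$ of $\mathcal P(\omega_1)/NS$, there are such $G$ and $B$ with $\Gamma(G)=\gamma$.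 (3) Consequently, it is not true that every torsion-free group $G$ having a basic subgroup $B$ of infinite rank such that all subgroups $H$ of $G$ with $H\cap B=0$ are free is itself free. -/

import Mathlib

open scoped Cardinal Ordinal

/-- The abelian group `A` is free (as a `ℤ`-module). -/
abbrev IsFreeAb (A : Type*) [AddCommGroup A] : Prop := Module.Free ℤ A

/-- `A` is `ℵ₁`-free: all its countable subgroups are free. -/
def IsAleph1Free (A : Type*) [AddCommGroup A] : Prop :=
  ∀ H : AddSubgroup A, Countable H → IsFreeAb H

/-- `A` is `ℵ₁`-separable: every countable subset of `A` is contained in a countable free direct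
summand of `A`. -/
def IsAleph1Separable (A : Type*) [AddCommGroup A] : Prop :=
  ∀ X : Set A, X.Countable → ∃ D : AddSubgroup A,
    X ⊆ D ∧ Countable D ∧ IsFreeAb D ∧ ∃ C : AddSubgroup A, IsCompl D C

/-- `B` is a pure subgroup of `A`: an element of `B` divisible by `n` in `A` is divisible by `n`
in `B`. -/
def IsPureSubgroup {A : Type*} [AddCommGroup A] (B : AddSubgroup A) : Prop :=
  ∀ (n : ℤ) (a : A), n • a ∈ B → ∃ b ∈ B, n • b = n • a

/-- `A` is divisible. -/
def IsDivisibleAb (A : Type*) [AddCommGroup A] : Prop :=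
  ∀ (n : ℤ), n ≠ 0 → ∀ a : A, ∃ c : A, n • c = a

/-- `B` is a basic subgroup of the torsion-free group `A`. (For torsion-free `A`, a subgroup is a
direct sum of cyclic groups exactly when it is free.) -/
structure IsBasicSubgroup {A : Type*} [AddCommGroup A] (B : AddSubgroup A) : Prop where
  free : IsFreeAb B
  pure : IsPureSubgroup B
  divisible : IsDivisibleAb (A ⧸ B)

/-- The set of countable ordinals, i.e. the ordinal `ω₁ = ℵ₁`. -/
abbrev CountableOrdinal : Type 1 := Set.Iio (ω₁ : Ordinal.{0})

theorem cof_countableOrdinal_ne : Order.cof CountableOrdinal ≠ ℵ₀ := by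
  rw [Ordinal.cof_Iio, Ordinal.lift_omega, ← Cardinal.ord_aleph, Ordinal.lift_one,
    Cardinal.isRegular_aleph_one.cof_ord]
  exact Cardinal.aleph0_lt_aleph_one.ne'

/-- Two subsets of `ω₁` are equivalent when their symmetric difference is non-stationary. -/
def nonstationarySetoid : Setoid (Set CountableOrdinal) where
  r S T := ¬ IsStationary (symmDiff S T)
  iseqv :=
    { refl := fun S => by simp
      symm := fun {S T} h => by rwa [symmDiff_comm]
      trans := fun {S T U} h₁ h₂ h => by
        rcases (isStationary_union_iff cof_countableOrdinal_ne).1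
          (h.mono (symmDiff_triangle S T U)) with h | h
        exacts [h₁ h, h₂ h] }

/-- (The underlying set of) the Boolean algebra `𝒫(ω₁)/NS`. -/
def PowModNS : Type 1 := Quotient nonstationarySetoid

/-- The class of a subset of `ω₁` in `𝒫(ω₁)/NS`. -/
def PowModNS.mk (S : Set CountableOrdinal) : PowModNS := Quotient.mk nonstationarySetoid S

/-- The zero of `𝒫(ω₁)/NS` is the class of the empty set. -/
instance PowModNS.instZero : Zero PowModNS := ⟨PowModNS.mk ∅⟩

/-- An `ω₁`-filtration of `A`: a continuous increasing chain of countable subgroups, indexed by the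
countable ordinals, with union `A`. -/
structure IsOmega1Filtration {A : Type*} [AddCommGroup A]
    (F : CountableOrdinal → AddSubgroup A) : Prop where
  countable : ∀ ν, Countable (F ν)
  mono : Monotone F
  continuous : ∀ ν, Order.IsSuccLimit ν → ∀ a ∈ F ν, ∃ μ < ν, a ∈ F μ
  exhaustive : ∀ a : A, ∃ ν, a ∈ F ν

/-- The class in `𝒫(ω₁)/NS` of the set of all `ν` such that `A / F ν` is not `ℵ₁`-free. -/
def gammaClass {A : Type*} [AddCommGroup A] (F : CountableOrdinal → AddSubgroup A) : PowModNS :=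
  PowModNS.mk {ν | ¬ IsAleph1Free (A ⧸ F ν)}

/-- The Gamma invariant of `A` is `γ`: there are `ω₁`-filtrations of `A`, and each of them
yields the class `γ`. -/
def HasGammaInvariant (A : Type*) [AddCommGroup A] (γ : PowModNS) : Prop :=
  (∃ F : CountableOrdinal → AddSubgroup A, IsOmega1Filtration F) ∧
    ∀ F : CountableOrdinal → AddSubgroup A, IsOmega1Filtration F → gammaClass F = γ

/-- `A` is a non-free `ℵ₁`-separable torsion-free group of size `ℵ₁`, and `B` is a basic subgroup
of `A` of rank `ℵ₁` such that all subgroups of `A` disjoint from `B` are free. -/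
structure IsIrwinCounterexample (A : Type) [AddCommGroup A] (B : AddSubgroup A) : Prop where
  torsionFree : IsAddTorsionFree A
  card_eq : #A = ℵ₁
  separable : IsAleph1Separable A
  basic : IsBasicSubgroup B
  rank_eq : Module.rank ℤ B = ℵ₁
  free_of_disjoint : ∀ H : AddSubgroup A, H ⊓ B = ⊥ → IsFreeAb H
  not_free : ¬ IsFreeAb A

/-! ### Free abelian groups -/

/-! Fix a stationary set `S` of countable limit ordinals, a ladder cofinal in each `δ ∈ S`, and the
2-adic integer `σ = ∑ 2 ^ (n ^ 2)`. Over each index sit `z`, `y`, `x` and free generators `e_q` for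
rational `q`. In `ladderGroup`, `2 ^ (n ^ 2)` divides `z_δ + s_n y_δ` plus a finite combination of
the `x` on the rungs of `δ`, where `s_n` is the `n`-th partial sum of `σ`.

Ladders are almost disjoint, so elements supported in a fixed finite set have bounded denominators;
this gives `ℵ₁`-freeness (`exists_common_denominator`). A stage that no later ladder meets
infinitely often is a summand (`exists_projection_ladderStage`), which gives separability and good
quotients off `S`. At `δ ∈ S` the rungs vanish modulo the earlier stage, leaving `2 ^ (n ^ 2) ∣ z +
s_n y` for all `n`. Since `σ` is irrational, homomorphisms from the group generated by these
quotients to `ℤ` kill `y`, so the quotient is not `ℵ₁`-free. Hence the Gamma invariant is the class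
of `S`, and the group is not free.

The basic subgroup is the kernel `B` of `z ↦ 1`, `y, x ↦ 0`, `e_q ↦ q`, with quotient a direct sum
of copies of `ℚ`. Let `H ∩ B = 0`, and filter `H` by its traces on the stages. If the quotient of
`H` at `δ` is bad, then some `v ∈ H` supported up to `δ` has a nonzero top coordinate killed by that
map; otherwise the top coordinates form an `ℵ₁`-free group (`isAleph1Free_of_fiberHom`). Two such
`v` at different `δ` with the same top value and lower part would differ by a nonzero element of `H
∩ B` (`eq_of_code_eq`). The lower part lives at an earlier stage and fibres are countable, so by
Fodor the bad `δ` are nonstationary and `H` is free. -/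

theorem IsFreeAb.of_addEquiv {A A' : Type*} [AddCommGroup A] [AddCommGroup A'] (e : A ≃+ A')
    (h : IsFreeAb A) : IsFreeAb A' :=
  Module.Free.of_equiv' h e.toIntLinearEquiv

theorem isFreeAb_toIntSubmodule {A : Type*} [AddCommGroup A] (K : AddSubgroup A)
    (h : IsFreeAb K) : Module.Free ℤ (AddSubgroup.toIntSubmodule K) :=
  Module.Free.of_equiv' h (AddEquiv.toIntLinearEquiv (AddEquiv.refl K))

/-- If `f` maps `Q` onto a free group with kernel `P`, then `P` has a free complement in `Q`. -/
theorem exists_free_complement {A C : Type*} [AddCommGroup A] [AddCommGroup C]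
    {P Q : AddSubgroup A} (f : A →+ C) (hP : ∀ x ∈ P, f x = 0)
    (hQ : ∀ x ∈ Q, f x = 0 → x ∈ P) (hfree : IsFreeAb (Q.map f)) :
    ∃ K : AddSubgroup A, IsFreeAb K ∧ Disjoint K P ∧ K ≤ Q ∧ ∀ x ∈ Q, ∃ k ∈ K, x - k ∈ P := by
  have := hfree
  let g : Q →+ Q.map f := (f.comp Q.subtype).codRestrict _ fun x => ⟨x, x.2, rfl⟩
  have hg : Function.Surjective g := by
    rintro ⟨_, x, hx, rfl⟩
    exact ⟨⟨x, hx⟩, rfl⟩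
  -- The free image is projective, so `g` splits; the range of the section is the complement.
  obtain ⟨s, hs⟩ := Module.projective_lifting_property g.toIntLinearMap LinearMap.id hg
  have hs' : ∀ y, f (s y) = y := fun y => congrArg Subtype.val (LinearMap.congr_fun hs y)
  have hinj : Function.Injective (Q.subtype.comp s.toAddMonoidHom) := fun a b hab => by
    apply Subtype.ext
    rw [← hs' a, ← hs' b]
    exact congrArg f hab
  refine ⟨(Q.subtype.comp s.toAddMonoidHom).range,
    hfree.of_addEquiv (AddMonoidHom.ofInjective hinj), ?_, ?_, ?_⟩
  · rw [AddSubgroup.disjoint_def]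
    rintro _ ⟨y, rfl⟩ hy
    have : y = 0 := Subtype.ext ((hs' y).symm.trans (hP _ hy))
    simp [this]
  · rintro _ ⟨y, rfl⟩
    exact (s y).2
  · intro x hx
    refine ⟨_, ⟨g ⟨x, hx⟩, rfl⟩, hQ _ (Q.sub_mem hx (s _).2) ?_⟩
    rw [map_sub, sub_eq_zero]
    exact (hs' (g ⟨x, hx⟩)).symm

/-- A group filtered by a well-ordered continuous chain with free quotients is free. -/
theorem isFreeAb_of_chain {A ι : Type*} [AddCommGroup A] [LinearOrder ι] [WellFoundedLT ι]
    (P Q : ι → AddSubgroup A) (hlt : ∀ i j, i < j → Q i ≤ P j)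
    (hlim : ∀ i, ∀ x ∈ P i, x = 0 ∨ ∃ j < i, x ∈ Q j) (hcov : ∀ x, ∃ i, x ∈ Q i)
    (hcompl : ∀ i, ∃ K : AddSubgroup A, IsFreeAb K ∧ Disjoint K (P i) ∧ K ≤ Q i ∧
      ∀ x ∈ Q i, ∃ k ∈ K, x - k ∈ P i) : IsFreeAb A := by
  classical
  choose K hfree hdisj hle hsum using hcompl
  let N : ι → Submodule ℤ A := fun i => AddSubgroup.toIntSubmodule (K i)
  have hN : ∀ i, Module.Free ℤ (N i) := fun i => isFreeAb_toIntSubmodule _ (hfree i)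
  have hmem : ∀ i x, x ∈ N i ↔ x ∈ K i := fun i x => Iff.rfl
  have hind : iSupIndep N := by
    rw [iSupIndep_iff_finsetSum_eq_zero_imp_eq_zero]
    intro s v hv h0 i hi
    by_contra hne
    -- In a vanishing sum take the last nonzero term: all others lie in `P m`, so it lies in `K m ∩
    -- P m = 0`.
    obtain ⟨m, hm, hmax⟩ := (s.filter fun i => v i ≠ 0).exists_maximal
      ⟨i, Finset.mem_filter.2 ⟨hi, hne⟩⟩
    rw [Finset.mem_filter] at hm
    refine hm.2 ((AddSubgroup.disjoint_def.1 (hdisj m)) (hv m hm.1) ?_)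
    rw [← Finset.add_sum_erase _ _ hm.1, add_eq_zero_iff_eq_neg] at h0
    rw [h0]
    refine (P m).neg_mem ((P m).sum_mem fun j hj => ?_)
    rw [Finset.mem_erase] at hj
    by_cases hj0 : v j = 0
    · rw [hj0]; exact (P m).zero_mem
    · refine hlt j m (lt_of_le_of_ne ?_ hj.1) (hle j (hv j hj.2))
      by_contra hlt'
      exact hlt' (hmax (Finset.mem_filter.2 ⟨hj.2, hj0⟩) (le_of_not_ge hlt'))
  have htop : iSup N = ⊤ := by
    rw [eq_top_iff]
    have key : ∀ i, ∀ x ∈ Q i, x ∈ iSup N := by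
      intro i
      induction i using WellFoundedLT.induction with
      | ind i ih =>
        intro x hx
        obtain ⟨k, hk, hxk⟩ := hsum i x hx
        have h1 : k ∈ iSup N := Submodule.mem_iSup_of_mem i hk
        rw [← sub_add_cancel x k]
        refine add_mem ?_ h1
        rcases hlim i _ hxk with h | ⟨j, hj, h⟩
        · rw [h]; exact zero_mem _
        · exact ih j hj _ h
    intro x _
    obtain ⟨i, hi⟩ := hcov x
    exact key i x hi
  have hint := DirectSum.isInternal_submodule_of_iSupIndep_of_iSup_eq_top hind htop
  exact Module.Free.of_equiv (LinearEquiv.ofBijective (DirectSum.coeLinearMap N) hint)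

theorem isFreeAb_addSubgroup_int (H : AddSubgroup ℤ) : IsFreeAb H := by
  have h : Module.Free ℤ (AddSubgroup.toIntSubmodule H) := inferInstance
  exact Module.Free.of_equiv' h (AddEquiv.toIntLinearEquiv (AddEquiv.refl H))

/-- Well-order the index set and filter by the position of the last nonzero coordinate; each factor
embeds in `ℤ`. -/
theorem isFreeAb_addSubgroup_finsupp {ι : Type*} (H : AddSubgroup (ι →₀ ℤ)) : IsFreeAb H := by
  obtain ⟨_, _⟩ := exists_wellFoundedLT ι
  let P : ι → AddSubgroup H := fun i =>
    { carrier := {x | ∀ j, i ≤ j → x.1 j = 0}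
      add_mem' := fun ha hb j hj => by simp [ha j hj, hb j hj]
      zero_mem' := fun j hj => rfl
      neg_mem' := fun ha j hj => by simp [ha j hj] }
  let Q : ι → AddSubgroup H := fun i =>
    { carrier := {x | ∀ j, i < j → x.1 j = 0}
      add_mem' := fun ha hb j hj => by simp [ha j hj, hb j hj]
      zero_mem' := fun j hj => rfl
      neg_mem' := fun ha j hj => by simp [ha j hj] }
  have hmax : ∀ x : H, x ≠ 0 → ∃ m, x.1 m ≠ 0 ∧ x ∈ Q m := by
    intro x hx
    have hne : x.1.support.Nonempty := Finsupp.support_nonempty_iff.2 fun h => hx (Subtype.ext h)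
    obtain ⟨m, hm, hmax⟩ := x.1.support.exists_maximal hne
    refine ⟨m, Finsupp.mem_support_iff.1 hm, fun j hj => ?_⟩
    by_contra h0
    exact hj.not_ge (hmax (Finsupp.mem_support_iff.2 h0) hj.le)
  cases isEmpty_or_nonempty ι
  · have : Subsingleton H := ⟨fun a b => Subtype.ext (Subsingleton.elim _ _)⟩
    exact Module.Free.of_subsingleton ℤ H
  refine isFreeAb_of_chain P Q (fun i j hij x hx k hk => hx k (hij.trans_le hk))
    (fun i x hx => ?_) (fun x => ?_) fun i => ?_
  · by_cases h0 : x = 0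
    · exact Or.inl h0
    · obtain ⟨m, hm, hQ⟩ := hmax x h0
      exact Or.inr ⟨m, lt_of_not_ge fun h => hm (hx m h), hQ⟩
  · by_cases h0 : x = 0
    · exact ⟨Classical.arbitrary ι, h0 ▸ zero_mem _⟩
    · obtain ⟨m, -, hQ⟩ := hmax x h0
      exact ⟨m, hQ⟩
  · refine exists_free_complement ((Finsupp.applyAddHom i).comp H.subtype)
      (fun x hx => hx i le_rfl) (fun x hx h0 j hj => ?_) (isFreeAb_addSubgroup_int _)
    rcases hj.eq_or_lt with rfl | h
    · exact h0
    · exact hx j h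

/-- A group that embeds into a free abelian group is free. -/
theorem IsFreeAb.of_injective {A A' : Type*} [AddCommGroup A] [AddCommGroup A'] (f : A →+ A')
    (hf : Function.Injective f) (h : IsFreeAb A') : IsFreeAb A := by
  have := h
  let g : A →+ (Module.Free.ChooseBasisIndex ℤ A' →₀ ℤ) :=
    ((Module.Free.chooseBasis ℤ A').repr.toAddEquiv : A' →+ _).comp f
  have hg : Function.Injective g := (Module.Free.chooseBasis ℤ A').repr.injective.comp hf
  exact (isFreeAb_addSubgroup_finsupp g.range).of_addEquiv (AddMonoidHom.ofInjective hg).symm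

theorem IsFreeAb.addSubgroup {A : Type*} [AddCommGroup A] (h : IsFreeAb A) (H : AddSubgroup A) :
    IsFreeAb H :=
  h.of_injective H.subtype H.subtype_injective

/-- An extension of free abelian groups is free. -/
theorem isFreeAb_of_ker {A C : Type*} [AddCommGroup A] [AddCommGroup C] (f : A →+ C)
    (hker : IsFreeAb f.ker) (hC : IsFreeAb C) : IsFreeAb A := by
  obtain ⟨K, hK, hd, -, hs⟩ := exists_free_complement (P := f.ker) (Q := ⊤) f (fun x hx => hx)
    (fun x _ hx => hx) (hC.addSubgroup _)
  have := hK
  have := hker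
  let g : K × f.ker →+ A := K.subtype.coprod f.ker.subtype
  have hg : Function.Bijective g := by
    constructor
    · rw [injective_iff_map_eq_zero]
      rintro ⟨k, x⟩ h
      have h' : (k : A) + x = 0 := h
      have hk : (k : A) = 0 := (AddSubgroup.disjoint_def.1 hd) k.2 (by
        rw [add_eq_zero_iff_eq_neg.1 h']; exact neg_mem x.2)
      have hx : (x : A) = 0 := by rwa [hk, zero_add] at h'
      exact Prod.ext (Subtype.ext hk) (Subtype.ext hx)
    · intro x
      obtain ⟨k, hk, h⟩ := hs x trivial
      exact ⟨(⟨k, hk⟩, ⟨_, h⟩), add_sub_cancel k x⟩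
  exact IsFreeAb.of_addEquiv (AddEquiv.ofBijective g hg) (Module.Free.prod ..)

theorem IsFreeAb.isAleph1Free {A : Type*} [AddCommGroup A] (h : IsFreeAb A) : IsAleph1Free A :=
  fun H _ => h.addSubgroup H

/-- An extension of `ℵ₁`-free groups is `ℵ₁`-free. -/
theorem IsAleph1Free.of_ker {A C : Type*} [AddCommGroup A] [AddCommGroup C] (f : A →+ C)
    (hker : IsAleph1Free f.ker) (hC : IsAleph1Free C) : IsAleph1Free A := by
  intro H _
  let g : H →+ H.map f := (f.comp H.subtype).codRestrict _ fun x => ⟨x, x.2, rfl⟩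
  have hcount : Countable (H.map f) := (Set.to_countable (H : Set A)).image f |>.to_subtype
  refine isFreeAb_of_ker g ?_ (hC _ hcount)
  let k : g.ker →+ f.ker := (H.subtype.comp g.ker.subtype).codRestrict _
    fun x => congrArg Subtype.val x.2
  have hk : Function.Injective k := fun a b hab => by
    have hab' : (k a : A) = k b := congrArg Subtype.val hab
    exact Subtype.ext (Subtype.ext hab')
  have : Countable k.range := (Set.countable_range k).to_subtype
  exact (hker k.range this).of_addEquiv (AddMonoidHom.ofInjective hk).symm

theorem IsAleph1Free.of_injective {A C : Type*} [AddCommGroup A] [AddCommGroup C] (f : A →+ C)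
    (hf : Function.Injective f) (hC : IsAleph1Free C) : IsAleph1Free A := by
  refine .of_ker f (IsFreeAb.isAleph1Free ?_) hC
  have : Subsingleton f.ker := by
    rw [(AddMonoidHom.ker_eq_bot_iff f).2 hf]; infer_instance
  exact Module.Free.of_subsingleton ℤ _

/-! ### Club sets of countable ordinals -/

namespace CountableOrdinal

theorem countable_Iio (ν : CountableOrdinal) : (Set.Iio ν).Countable := by
  have h : (Set.Iio ν.1).Countable := by
    have hν : ν.1.card < ℵ₁ := by
      rw [← Cardinal.lt_ord, Cardinal.ord_aleph]
      exact ν.2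
    rw [← Cardinal.le_aleph0_iff_set_countable, Cardinal.mk_Iio_ordinal,
      ← Cardinal.lift_aleph0.{1, 0}, Cardinal.lift_le]
    exact Cardinal.lt_aleph_one_iff.1 hν
  exact h.preimage Subtype.val_injective

theorem countable_Iic (ν : CountableOrdinal) : (Set.Iic ν).Countable := by
  rw [← Set.Iio_insert]
  exact (countable_Iio ν).insert ν

theorem exists_gt_of_countable {s : Set CountableOrdinal} (hs : s.Countable) :
    ∃ ν, ∀ x ∈ s, x < ν := by
  have := hs.to_subtype
  have hsucc : ∀ x : s, Order.succ x.1.1 < ω₁ := fun x =>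
    (Cardinal.isSuccLimit_omega 1).succ_lt x.1.2
  refine ⟨⟨⨆ x : s, Order.succ x.1.1, Ordinal.iSup_lt_omega_one hsucc⟩, fun x hx => ?_⟩
  have hbdd : BddAbove (Set.range fun x : s => Order.succ x.1.1) :=
    ⟨ω₁, Set.forall_mem_range.2 fun x => (hsucc x).le⟩
  exact (Order.lt_succ x.1).trans_le (le_ciSup hbdd ⟨x, hx⟩)

instance : NoMaxOrder CountableOrdinal :=
  ⟨fun a => (exists_gt_of_countable (Set.countable_singleton a)).imp fun _ h => h a rfl⟩

instance : Nonempty CountableOrdinal :=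
  ⟨(exists_gt_of_countable Set.countable_empty).choose⟩

/-- Closing-off argument: closed points are reached as suprema of `ω` iterations of a function
dominating `f`. -/
theorem isClub_closed (f : CountableOrdinal → CountableOrdinal) :
    IsClub {ν | Order.IsSuccLimit ν ∧ ∀ μ < ν, f μ < ν} := by
  constructor
  · intro d hd hne _ a ha
    refine ⟨⟨fun hmin => ?_, fun b hb => ?_⟩, fun μ hμ => ?_⟩
    · obtain ⟨x, hx⟩ := hne
      exact (hd hx).1.1 (hmin.mono (ha.1 hx))
    · obtain ⟨x, hx, hbx⟩ := (lt_isLUB_iff ha).1 hb.lt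
      -- If `a` covered `b`, a member of `d` above `b` would have to be `a` itself, which is then a
      -- limit.
      obtain rfl := (ha.1 hx).eq_of_not_lt fun h => hb.2 hbx h
      exact (hd hx).1.2 b hb
    · obtain ⟨x, hx, hμx⟩ := (lt_isLUB_iff ha).1 hμ
      exact ((hd hx).2 μ hμx).trans_le (ha.1 hx)
  · intro a
    have hg : ∀ μ, ∃ ν, μ < ν ∧ ∀ μ' ≤ μ, f μ' < ν := fun μ => by
      obtain ⟨ν, hν⟩ := exists_gt_of_countable (((countable_Iic μ).image f).insert μ)
      exact ⟨ν, hν _ (Set.mem_insert _ _),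
        fun μ' h => hν _ (Set.mem_insert_of_mem _ ⟨μ', h, rfl⟩)⟩
    choose g hlt hf using hg
    let h : ℕ → CountableOrdinal := fun n => g^[n] a
    have hsucc : ∀ n, h (n + 1) = g (h n) := fun n => Function.iterate_succ_apply' g n a
    obtain ⟨ub, hub⟩ := exists_gt_of_countable (Set.countable_range h)
    obtain ⟨ν, hν, hmin⟩ := WellFounded.has_min (wellFounded_lt (α := CountableOrdinal))
      {x | ∀ n, h n < x} ⟨ub, fun n => hub _ ⟨n, rfl⟩⟩
    have key : ∀ μ < ν, ∃ n, μ ≤ h n := by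
      intro μ hμ
      by_contra! hcon
      exact hmin μ hcon hμ
    refine ⟨ν, ⟨⟨fun hm => ?_, fun b hb => ?_⟩, fun μ hμ => ?_⟩, (hν 0).le⟩
    · exact hm.not_lt (hν 0)
    · obtain ⟨n, hn⟩ := key b hb.lt
      exact hb.2 (hn.trans_lt ((hlt (h n)).trans_eq (hsucc n).symm)) (hν (n + 1))
    · obtain ⟨n, hn⟩ := key μ hμ
      exact (hf (h n) μ hn).trans (hsucc n ▸ hν (n + 1))

/-- A form of Fodor's lemma: an injective map that sends every element of `E` to an earlier stage
of a chain of countable sets exists only for nonstationary `E`. -/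
theorem not_isStationary_of_injOn {T : Type*} {E : Set CountableOrdinal}
    (c : CountableOrdinal → T) (hc : Set.InjOn c E) (s : CountableOrdinal → Set T)
    (hs : ∀ ν, (s ν).Countable) (hreg : ∀ δ ∈ E, ∃ μ < δ, c δ ∈ s μ) : ¬ IsStationary E := by
  -- By injectivity each countable `s μ` catches only countably many `δ ∈ E`, so they are bounded,
  -- say by `f μ`; no `δ ∈ E` can then be closed under `f`.
  have hbd : ∀ μ, ∃ ν, ∀ δ ∈ {δ ∈ E | c δ ∈ s μ}, δ < ν := fun μ => by
    refine exists_gt_of_countable ?_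
    refine Set.MapsTo.countable_of_injOn (f := c) (t := s μ) (fun δ hδ => hδ.2)
      (hc.mono fun δ hδ => hδ.1) (hs μ)
  choose f hf using hbd
  rw [not_isStationary_iff]
  refine ⟨_, isClub_closed f, Set.disjoint_left.2 fun δ hδ hcl => ?_⟩
  obtain ⟨μ, hμ, hmem⟩ := hreg δ hδ
  exact (hf μ δ ⟨hδ, hmem⟩).not_gt (hcl.2 μ hμ)

end CountableOrdinal

/-! ### Filtrations -/

section Filtration

variable {A : Type*} [AddCommGroup A] {F F' : CountableOrdinal → AddSubgroup A}

theorem IsOmega1Filtration.exists_le (hF : IsOmega1Filtration F) {s : Set A} (hs : s.Countable) :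
    ∃ ν, s ⊆ F ν := by
  choose r hr using hF.exhaustive
  obtain ⟨ν, hν⟩ := CountableOrdinal.exists_gt_of_countable (hs.image r)
  exact ⟨ν, fun a ha => hF.mono (hν _ ⟨a, ha, rfl⟩).le (hr a)⟩

/-- Two filtrations of the same group agree on a club. -/
theorem IsOmega1Filtration.exists_isClub_eq (hF : IsOmega1Filtration F)
    (hF' : IsOmega1Filtration F') : ∃ C, IsClub C ∧ ∀ ν ∈ C, F ν = F' ν := by
  have h1 : ∀ μ, ∃ ν, (F μ : Set A) ⊆ F' ν := fun μ =>
    hF'.exists_le (have := hF.countable μ; Set.to_countable _)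
  have h2 : ∀ μ, ∃ ν, (F' μ : Set A) ⊆ F ν := fun μ =>
    hF.exists_le (have := hF'.countable μ; Set.to_countable _)
  choose f hf using h1
  choose f' hf' using h2
  refine ⟨_, CountableOrdinal.isClub_closed fun μ => max (f μ) (f' μ), fun ν hν => ?_⟩
  ext x
  constructor <;> intro hx
  · obtain ⟨μ, hμ, hx⟩ := hF.continuous ν hν.1 x hx
    exact hF'.mono (max_lt_iff.1 (hν.2 μ hμ)).1.le (hf μ hx)
  · obtain ⟨μ, hμ, hx⟩ := hF'.continuous ν hν.1 x hx
    exact hF.mono (max_lt_iff.1 (hν.2 μ hμ)).2.le (hf' μ hx)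

theorem IsAleph1Free.quotient_of_hom {C : Type*} [AddCommGroup C] {P : AddSubgroup A}
    (f : A →+ C) (hf : ∀ x, f x = 0 ↔ x ∈ P) (hC : IsAleph1Free C) : IsAleph1Free (A ⧸ P) := by
  refine hC.of_injective (QuotientAddGroup.lift P f fun x hx => (hf x).2 hx) ?_
  rw [injective_iff_map_eq_zero]
  intro q
  induction q using QuotientAddGroup.induction_on with
  | H x => exact fun h => (QuotientAddGroup.eq_zero_iff x).2 ((hf x).1 h)

theorem IsAleph1Free.quotient_comap {P : AddSubgroup A} (h : IsAleph1Free (A ⧸ P))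
    (H : AddSubgroup A) : IsAleph1Free (H ⧸ P.comap H.subtype) :=
  .quotient_of_hom ((QuotientAddGroup.mk' P).comp H.subtype)
    (fun x => QuotientAddGroup.eq_zero_iff (x : A)) h

/-- A criterion for `A ⧸ P` to be `ℵ₁`-free, for `P` the intersection of two kernels. -/
theorem IsAleph1Free.quotient_of_hom_of_hom {C L : Type*} [AddCommGroup C] [AddCommGroup L]
    {P : AddSubgroup A} (f : A →+ C) (g : A →+ L) (hP : ∀ x, f x = 0 ∧ g x = 0 ↔ x ∈ P)
    (hC : IsAleph1Free C) (hL : IsAleph1Free (f.ker.map g)) : IsAleph1Free (A ⧸ P) := by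
  let φ : A ⧸ P →+ C := QuotientAddGroup.lift P f fun x hx => ((hP x).2 hx).1
  let ψ : A ⧸ P →+ L := QuotientAddGroup.lift P g fun x hx => ((hP x).2 hx).2
  refine .of_ker φ ?_ hC
  have hmem : ∀ q : φ.ker, ψ q ∈ f.ker.map g := by
    rintro ⟨q, hq⟩
    induction q using QuotientAddGroup.induction_on with
    | H x => exact ⟨x, hq, rfl⟩
  refine hL.of_injective ((ψ.comp φ.ker.subtype).codRestrict _ hmem) ?_
  rw [injective_iff_map_eq_zero]
  rintro ⟨q, hq⟩ h
  induction q using QuotientAddGroup.induction_on with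
  | H x =>
    have hx : g x = 0 := congrArg Subtype.val h
    exact Subtype.ext ((QuotientAddGroup.eq_zero_iff x).2 ((hP x).1 ⟨hq, hx⟩))

/-- A group whose quotients by the members of a filtration are mostly `ℵ₁`-free is free. -/
theorem IsOmega1Filtration.isFreeAb (hF : IsOmega1Filtration F) (hA : IsAleph1Free A)
    (hE : ¬ IsStationary {ν | ¬ IsAleph1Free (A ⧸ F ν)}) : IsFreeAb A := by
  obtain ⟨C, hC, hdisj⟩ := not_isStationary_iff.1 hE
  have hfree : ∀ ν ∈ C, IsAleph1Free (A ⧸ F ν) := fun ν hν => by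
    by_contra h
    exact Set.disjoint_left.1 hdisj h hν
  -- Index the chain by the club only; `P i` is the union of the earlier members, and is again a
  -- member of the filtration because `C` is closed.
  let P : C → AddSubgroup A := fun i => ⨆ j : {j : C // j < i}, F j.1
  have hdir : ∀ i : C, Directed (· ≤ ·) fun j : {j : C // j < i} => F j.1 := fun i =>
    Monotone.directed_le fun a b hab => hF.mono hab
  have hP : ∀ (i : C) x, x ∈ P i → x = 0 ∨ ∃ j < i, x ∈ F j := by
    intro i x hx
    cases isEmpty_or_nonempty {j : C // j < i}
    · left
      simpa only [P, iSup_of_empty, AddSubgroup.mem_bot] using hx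
    · obtain ⟨j, hj⟩ := (AddSubgroup.mem_iSup_of_directed (hdir i)).1 hx
      exact Or.inr ⟨j.1, j.2, hj⟩
  have hlt : ∀ i j : C, i < j → F i ≤ P j := fun i j hij =>
    le_iSup (fun k : {k : C // k < j} => F k.1) ⟨i, hij⟩
  refine isFreeAb_of_chain P (fun i : C => F i) hlt hP (fun x => ?_) fun i => ?_
  · obtain ⟨ν, hν⟩ := hF.exhaustive x
    obtain ⟨μ, hμ, hle⟩ := hC.isCofinal ν
    exact ⟨⟨μ, hμ⟩, hF.mono hle hν⟩
  · have hcount := hF.countable i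
    by_cases hne : ∃ j : C, j < i
    · have hub : BddAbove {j : CountableOrdinal | j ∈ C ∧ j < i} := ⟨i.1, fun j hj => hj.2.le⟩
      obtain ⟨m, hm⟩ : ∃ m, IsLUB {j : CountableOrdinal | j ∈ C ∧ j < i} m := by
        obtain ⟨m, hm, hmin⟩ := WellFounded.has_min (wellFounded_lt (α := CountableOrdinal))
          (upperBounds {j : CountableOrdinal | j ∈ C ∧ j < i}) hub
        exact ⟨m, hm, fun x hx => le_of_not_gt (hmin x hx)⟩
      have hmC : m ∈ C := by
        obtain ⟨j, hj⟩ := hne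
        exact hC.isLUB_mem (t := {j | j ∈ C ∧ j < i}) (fun j hj => hj.1) ⟨j.1, j.2, hj⟩ hm
      have hPm : P i = F m := by
        refine le_antisymm (iSup_le fun j => hF.mono (hm.1 ⟨j.1.2, j.2⟩)) fun x hx => ?_
        by_cases hmi : m < i
        · exact hlt ⟨m, hmC⟩ i hmi hx
        have hlub : ∀ μ < m, ∃ j : C, j < i ∧ μ < j := fun μ hμ => by
          obtain ⟨j, hj, h⟩ := (lt_isLUB_iff hm).1 hμ
          exact ⟨⟨j, hj.1⟩, hj.2, h⟩
        have him : i.1 ≤ m := le_of_not_gt hmi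
        have hlim : Order.IsSuccLimit m := by
          refine ⟨fun hmin => ?_, fun b hb => ?_⟩
          · obtain ⟨j, hj⟩ := hne
            exact hmin.not_lt (lt_of_lt_of_le hj him)
          · obtain ⟨j, hj, h⟩ := hlub b hb.lt
            exact hb.2 h (lt_of_lt_of_le hj him)
        obtain ⟨μ, hμ, hx⟩ := hF.continuous m hlim x hx
        obtain ⟨j, hj, h⟩ := hlub μ hμ
        exact hlt j i hj (hF.mono h.le hx)
      refine exists_free_complement (QuotientAddGroup.mk' (F m)) (fun x hx => ?_)
        (fun x _ hx => ?_) (hfree m hmC _ ?_)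
      · rw [hPm] at hx
        exact (QuotientAddGroup.eq_zero_iff x).2 hx
      · rw [hPm]
        exact (QuotientAddGroup.eq_zero_iff x).1 hx
      · exact ((Set.to_countable (F i : Set A)).image _).to_subtype
    -- At the least element of `C` there is no quotient to use; the countable `F i` is itself free
    -- since `A` is `ℵ₁`-free.
    · have hbot : P i = ⊥ := by
        have : IsEmpty {j : C // j < i} := ⟨fun j => hne ⟨j.1, j.2⟩⟩
        exact iSup_of_empty _
      rw [hbot]
      exact ⟨F i, hA _ hcount, disjoint_bot_right, le_rfl, fun x hx => ⟨x, hx, by simp⟩⟩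

/-- All filtrations of a free group have mostly `ℵ₁`-free quotients. -/
theorem IsOmega1Filtration.not_isStationary_of_isFreeAb (hF : IsOmega1Filtration F)
    (hA : IsFreeAb A) : ¬ IsStationary {ν | ¬ IsAleph1Free (A ⧸ F ν)} := by
  classical
  have := hA
  let b := Module.Free.chooseBasis ℤ A
  -- Close off under basis supports: on a club `F ν` is spanned by the basis elements it contains,
  -- so the quotient embeds in the free group on the others.
  have hf : ∀ μ, ∃ ν, (⋃ x ∈ F μ, b '' (b.repr x).support) ⊆ (F ν : Set A) := fun μ =>
    hF.exists_le <| (have := hF.countable μ; Set.to_countable (F μ : Set A)).biUnion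
      fun x _ => ((b.repr x).support.finite_toSet.image b).countable
  choose f hf using hf
  rw [not_isStationary_iff]
  refine ⟨_, CountableOrdinal.isClub_closed f, Set.disjoint_left.2 fun ν hν hcl => hν ?_⟩
  let I := {i | b i ∈ F ν}
  have hsupp : ∀ x ∈ F ν, ∀ i ∉ I, b.repr x i = 0 := by
    intro x hx i hi
    by_contra h0
    obtain ⟨μ, hμ, hx⟩ := hF.continuous ν hcl.1 x hx
    refine hi (hF.mono (hcl.2 μ hμ).le (hf μ ?_))
    exact Set.mem_biUnion hx ⟨i, Finsupp.mem_support_iff.2 h0, rfl⟩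
  refine IsAleph1Free.quotient_of_hom (C := _ →₀ ℤ)
    ((Finsupp.filterAddHom (· ∉ I)).comp (b.repr.toAddEquiv : A →+ _)) (fun x => ?_)
    (IsFreeAb.isAleph1Free (Module.Free.finsupp ..))
  constructor
  · intro h
    have h' : ∀ i ∉ I, b.repr x i = 0 := fun i hi => by
      have := DFunLike.congr_fun h i
      simpa [Finsupp.filterAddHom, hi] using this
    rw [← b.linearCombination_repr x, Finsupp.linearCombination_apply, Finsupp.sum]
    refine (F ν).sum_mem fun i hi => (F ν).zsmul_mem ?_ _
    by_contra hiI
    exact Finsupp.mem_support_iff.1 hi (h' i hiI)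
  · intro hx
    ext i
    by_cases hi : i ∈ I
    · simp [Finsupp.filterAddHom, hi]
    · simpa [Finsupp.filterAddHom, hi] using hsupp x hx i hi

end Filtration

/-! ### A 2-adic number with lacunary expansion -/

/-- The moduli `2 ^ (n ^ 2)`. -/
def modulus (n : ℕ) : ℤ := 2 ^ (n ^ 2)

/-- The approximations of the irrational 2-adic integer `∑ 2 ^ (n ^ 2)`. -/
def adicSum (n : ℕ) : ℤ := ∑ i ∈ Finset.range n, modulus i

/-- The integers, as a subgroup of the rationals. -/
def ratInt : AddSubgroup ℚ := (Int.castAddHom ℚ).range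

theorem mem_ratInt {x : ℚ} : x ∈ ratInt ↔ ∃ k : ℤ, (k : ℚ) = x := Iff.rfl

theorem intCast_mem_ratInt (k : ℤ) : (k : ℚ) ∈ ratInt := ⟨k, rfl⟩

theorem intCast_mul_mem_ratInt (k : ℤ) {x : ℚ} (hx : x ∈ ratInt) : (k : ℚ) * x ∈ ratInt := by
  obtain ⟨m, rfl⟩ := hx
  exact ⟨k * m, by simp⟩

theorem modulus_pos (n : ℕ) : 0 < modulus n := by unfold modulus; positivity

theorem modulus_succ (n : ℕ) : modulus (n + 1) = modulus n * 2 ^ (2 * n + 1) := by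
  unfold modulus
  rw [← pow_add]
  congr 1
  ring

theorem modulus_dvd {m n : ℕ} (h : m ≤ n) : modulus m ∣ modulus n :=
  pow_dvd_pow 2 (Nat.pow_le_pow_left h 2)

theorem adicSum_succ (n : ℕ) : adicSum (n + 1) = adicSum n + modulus n :=
  Finset.sum_range_succ _ _

theorem adicSum_nonneg (n : ℕ) : 0 ≤ adicSum n :=
  Finset.sum_nonneg fun i _ => (modulus_pos i).le

theorem modulus_dvd_adicSum_sub {m n : ℕ} (h : m ≤ n) : modulus m ∣ adicSum n - adicSum m := by
  induction n, h using Nat.le_induction with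
  | base => simp
  | succ n hmn ih =>
    rw [adicSum_succ, add_sub_right_comm]
    exact dvd_add ih (modulus_dvd hmn)

theorem adicSum_le_modulus (n : ℕ) : adicSum n ≤ modulus n := by
  induction n with
  | zero => simp [adicSum, modulus]
  | succ n ih =>
    rw [adicSum_succ, modulus_succ]
    have h1 : (2 : ℤ) ≤ 2 ^ (2 * n + 1) := le_self_pow₀ (by norm_num) (by omega)
    nlinarith [modulus_pos n]

/-- This is lacunarity: the exponents jump by `2 * n + 1`, so a partial sum is smaller than the next
modulus by a factor of order `2 ^ n`. It lets fixed integer coefficients be absorbed. -/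
theorem adicSum_mul_two_pow_le (n : ℕ) : adicSum n * 2 ^ n ≤ 2 * modulus n := by
  cases n with
  | zero => simp [adicSum, modulus]
  | succ n =>
    rw [adicSum_succ, modulus_succ]
    have h1 : (2 : ℤ) ^ (2 * n + 1) = 2 ^ (n + 1) * 2 ^ n := by rw [← pow_add]; congr 1; ring
    have h2 : (1 : ℤ) ≤ 2 ^ n := one_le_pow₀ (by norm_num)
    have h3 : (1 : ℤ) ≤ 2 ^ (n + 1) := one_le_pow₀ (by norm_num)
    have h4 := adicSum_le_modulus n
    have h5 := modulus_pos n
    calc (adicSum n + modulus n) * 2 ^ (n + 1) ≤ (2 * modulus n) * 2 ^ (n + 1) := by gcongr; linarith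
      _ ≤ (2 * modulus n) * (2 ^ (n + 1) * 2 ^ n) := by
          gcongr
          exact le_mul_of_one_le_right (by positivity) h2
      _ = 2 * (modulus n * 2 ^ (2 * n + 1)) := by rw [h1]; ring

theorem exists_forall_abs_add_mul_adicSum_lt (f g : ℤ) :
    ∃ n₀, ∀ n ≥ n₀, |f + g * adicSum n| < modulus n := by
  -- Chosen so that, as `n < 2 ^ n`, the `f` term and the `g` term each use at most half of `modulus
  -- n`.
  refine ⟨(4 * |g| + 2 * |f| + 2).toNat, fun n hn => ?_⟩
  have hn' : 4 * |g| + 2 * |f| + 2 ≤ (n : ℤ) := Int.toNat_le.1 hn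
  have h2n : (n : ℤ) < 2 ^ n := by exact_mod_cast Nat.lt_two_pow_self
  have hnn : (2 : ℤ) ^ n ≤ modulus n := pow_le_pow_right₀ (by norm_num) (Nat.le_self_pow (by norm_num) n)
  have h1 : |f + g * adicSum n| ≤ |f| + |g| * adicSum n := by
    refine (abs_add_le _ _).trans_eq ?_
    rw [abs_mul, abs_of_nonneg (adicSum_nonneg n)]
  refine h1.trans_lt ?_
  have h3 := adicSum_mul_two_pow_le n
  have hg := abs_nonneg g
  have hf := abs_nonneg f
  have hpos : (0 : ℤ) < 2 ^ n := by positivity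
  refine lt_of_mul_lt_mul_right (a := 2 ^ n) ?_ hpos.le
  have h4 : |g| * (adicSum n * 2 ^ n) ≤ |g| * (2 * modulus n) := by gcongr
  have h5 : 4 * |g| * modulus n ≤ 2 ^ n * modulus n := by
    have := modulus_pos n
    gcongr
    linarith
  have h6 : 2 * |f| * 2 ^ n < modulus n * 2 ^ n := by
    gcongr
    linarith
  linarith

/-- Irrationality of `σ`: for large `n` the combination is smaller than its divisor `modulus n`,
hence zero; comparing `n` and `n + 1` kills `g`, then `f`. -/
theorem exists_not_modulus_dvd {f g : ℤ} (h : f ≠ 0 ∨ g ≠ 0) :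
    ∃ i, ¬ modulus i ∣ f + g * adicSum i := by
  by_contra! hdvd
  obtain ⟨n, hn⟩ := exists_forall_abs_add_mul_adicSum_lt f g
  have h0 := Int.eq_zero_of_abs_lt_dvd (hdvd n) (hn n le_rfl)
  have h1 := Int.eq_zero_of_abs_lt_dvd (hdvd (n + 1)) (hn (n + 1) (by omega))
  rw [adicSum_succ] at h1
  have h2 : g * modulus n = 0 := by linear_combination h1 - h0
  have hg : g = 0 := (mul_eq_zero.1 h2).resolve_right (modulus_pos n).ne'
  subst hg
  simp at h0
  simp [h0] at h

/-- Rank one subgroups of the group of all pairs `(a, b)` such that `b` is congruent to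
`a * ∑ 2 ^ (n ^ 2)` modulo the 2-adic integers are cyclic. -/
theorem exists_denominator_bound {a b : ℚ} (ha : a ≠ 0) :
    ∃ N : ℤ, N ≠ 0 ∧ ∀ t : ℚ,
      (∀ᶠ n in Filter.atTop, t * b - t * a * adicSum n ∈ ratInt) → (N : ℚ) * t ∈ ratInt := by
  obtain ⟨D, p, q, hD, rfl, rfl⟩ : ∃ D p q : ℤ, D ≠ 0 ∧ a = p / D ∧ b = q / D := by
    refine ⟨a.den * b.den, a.num * b.den, b.num * a.den, ?_, ?_, ?_⟩
    · have := a.den_nz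
      have := b.den_nz
      positivity
    · push_cast
      rw [mul_div_mul_right _ _ (by exact_mod_cast b.den_nz), Rat.num_div_den]
    · push_cast
      rw [mul_comm (a.den : ℚ), mul_div_mul_right _ _ (by exact_mod_cast a.den_nz),
        Rat.num_div_den]
  have hD' : (D : ℚ) ≠ 0 := by exact_mod_cast hD
  have hp : p ≠ 0 := by
    rintro rfl
    simp at ha
  obtain ⟨i, hi⟩ := exists_not_modulus_dvd (f := q) (g := -p) (Or.inr (neg_ne_zero.2 hp))
  refine ⟨p * modulus i, mul_ne_zero hp (modulus_pos i).ne', fun t ht => ?_⟩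
  obtain ⟨n₀, hn₀⟩ := Filter.eventually_atTop.1 ht
  -- Subtracting the conditions at `n₀` and `n₀ + 1` leaves `t * a * modulus n₀`, so the denominator
  -- of `t * p / D` is a power of two.
  have hU : ∃ k : ℕ, t / D * p * 2 ^ k ∈ ratInt := by
    refine ⟨n₀ ^ 2, ?_⟩
    have h := sub_mem (hn₀ n₀ le_rfl) (hn₀ (n₀ + 1) (by omega))
    rw [adicSum_succ] at h
    convert h using 1
    simp only [modulus]
    push_cast
    ring
  classical
  let k := Nat.find hU
  obtain ⟨u, hu⟩ := mem_ratInt.1 (Nat.find_spec hU)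
  change (u : ℚ) = t / D * p * 2 ^ k at hu
  -- With `k` minimal and positive, `u` is odd; if `k > i ^ 2`, integrality would force `modulus i`
  -- to divide `q - p * adicSum i`, against the choice of `i`.
  have hk : k ≤ i ^ 2 := by
    by_contra! hk
    refine hi ?_
    have hodd : IsCoprime ((2 : ℤ) ^ k) u := by
      refine IsCoprime.pow_left ?_
      suffices h : Odd u by
        obtain ⟨w, hw⟩ := h
        exact ⟨-w, 1, by rw [hw]; ring⟩
      rw [← Int.not_even_iff_odd]
      rintro ⟨w, hw⟩
      refine Nat.find_min hU (m := k - 1) (by change k - 1 < k; omega) ⟨w, ?_⟩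
      obtain ⟨k', hk'⟩ : ∃ k', k = k' + 1 := ⟨k - 1, by omega⟩
      rw [hk'] at hu ⊢
      rw [hw, pow_succ] at hu
      push_cast at hu
      simp only [Nat.add_sub_cancel, Int.coe_castAddHom]
      linarith
    let n := max n₀ i
    obtain ⟨z, hz⟩ := hn₀ n (le_max_left _ _)
    have h1 : u * (q + -p * adicSum n) = 2 ^ k * (p * z) := by
      have : ((u * (q + -p * adicSum n) : ℤ) : ℚ) = ((2 ^ k * (p * z) : ℤ) : ℚ) := by
        simp only [Int.coe_castAddHom] at hz
        push_cast
        rw [hu, hz]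
        field_simp
        ring
      exact_mod_cast this
    have h2 : (2 : ℤ) ^ k ∣ q + -p * adicSum n :=
      hodd.dvd_of_dvd_mul_left (h1 ▸ dvd_mul_right _ _)
    have h3 : modulus i ∣ q + -p * adicSum n := (pow_dvd_pow 2 hk.le).trans h2
    have h4 := modulus_dvd_adicSum_sub (le_max_right n₀ i)
    have h5 : q + -p * adicSum i = (q + -p * adicSum n) + p * (adicSum n - adicSum i) := by ring
    rw [h5]
    exact dvd_add h3 (h4.mul_left p)
  refine ⟨D * (u * 2 ^ (i ^ 2 - k)), ?_⟩
  simp only [Int.coe_castAddHom, modulus]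
  push_cast
  rw [hu, mul_assoc (t / D * p), ← pow_add, Nat.add_sub_cancel' hk]
  field_simp

/-! ### Groups built from ladder systems -/

/-- The fibre over an index: the coordinates `(a, b, c, f)` of `a • z + b • y + c • x + f`, where
`f` lies in a free group with generators indexed by `ℚ`. -/
abbrev LadderFiber : Type := ℚ × ℚ × ℚ × (ℚ →₀ ℤ)

/-- Weights on the rungs of a system of ladders: the ladder on `δ ∈ S` consists of the `i` with
`t δ i ≠ 0`. -/
structure IsWeightSystem {W : Type*} [LinearOrder W] (S : Set W) (t : W → W → ℤ) : Prop where
  lt_of_ne_zero : ∀ δ i, t δ i ≠ 0 → i < δ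
  eq_zero : ∀ δ ∉ S, ∀ i, t δ i = 0
  finite_below : ∀ δ, ∀ ν < δ, {i | i < ν ∧ t δ i ≠ 0}.Finite
  infinite : ∀ δ ∈ S, {i | t δ i ≠ 0}.Infinite
  finite_not_dvd : ∀ δ n, {i | ¬ modulus n ∣ t δ i}.Finite

section Ladder

variable {W : Type*}

/-- The weighted sum, over all ladders through `i`, of the `z`-coordinates. -/
noncomputable def ladderSum (t : W → W → ℤ) (i : W) : (W →₀ LadderFiber) →+ ℚ :=
  Finsupp.liftAddHom fun δ => (AddMonoidHom.mulRight (t δ i : ℚ)).comp (AddMonoidHom.fst ℚ _)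

theorem ladderSum_apply (t : W → W → ℤ) (i : W) (v : W →₀ LadderFiber) :
    ladderSum t i v = ∑ δ ∈ v.support, (v δ).1 * t δ i := rfl

theorem ladderSum_single (t : W → W → ℤ) (i δ : W) (m : LadderFiber) :
    ladderSum t i (Finsupp.single δ m) = m.1 * t δ i := by
  simp [ladderSum]

theorem ladderSum_eq_single {t : W → W → ℤ} {i δ : W} {v : W →₀ LadderFiber}
    (h : ∀ δ', δ' ≠ δ → (v δ').1 * t δ' i = 0) : ladderSum t i v = (v δ).1 * t δ i := by
  rw [ladderSum_apply]
  refine Finset.sum_eq_single δ (fun δ' _ hne => h δ' hne) fun hδ => ?_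
  rw [Finsupp.notMem_support_iff.1 hδ]
  simp

theorem ladderSum_eq_zero {t : W → W → ℤ} {i : W} {v : W →₀ LadderFiber}
    (h : ∀ δ, (v δ).1 * t δ i = 0) : ladderSum t i v = 0 :=
  Finset.sum_eq_zero fun δ _ => h δ

theorem ladderSum_congr {t : W → W → ℤ} {i : W} {v w : W →₀ LadderFiber}
    (h : ∀ δ, (v δ).1 = (w δ).1) : ladderSum t i v = ladderSum t i w := by
  rw [← sub_eq_zero, ← map_sub]
  exact ladderSum_eq_zero fun δ => by simp [h]

/-- The group attached to a system `t` of weighted ladders on the elements of `S`. -/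
def ladderGroup (S : Set W) (t : W → W → ℤ) : AddSubgroup (W →₀ LadderFiber) where
  -- The second condition makes `a` and `b` dyadic with `b - a * σ` a 2-adic integer; the third
  -- fixes each `x`-coordinate modulo `ℤ` from the ladders through it.
  carrier := {v | (∀ i ∉ S, (v i).1 = 0) ∧
    (∀ i, ∀ᶠ n in Filter.atTop, (v i).2.1 - (v i).1 * adicSum n ∈ ratInt) ∧
    ∀ i, (v i).2.2.1 - ladderSum t i v ∈ ratInt}
  add_mem' := by
    rintro v w ⟨hv1, hv2, hv3⟩ ⟨hw1, hw2, hw3⟩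
    refine ⟨fun i hi => by simp [hv1 i hi, hw1 i hi], fun i => ?_, fun i => ?_⟩
    · filter_upwards [hv2 i, hw2 i] with n h1 h2
      convert add_mem h1 h2 using 1
      simp only [Finsupp.add_apply, Prod.fst_add, Prod.snd_add]
      ring
    · convert add_mem (hv3 i) (hw3 i) using 1
      simp only [Finsupp.add_apply, Prod.fst_add, Prod.snd_add, map_add]
      ring
  zero_mem' := ⟨fun i _ => rfl, fun i => by simp [zero_mem], fun i => by simp [zero_mem]⟩
  neg_mem' := by
    rintro v ⟨hv1, hv2, hv3⟩
    refine ⟨fun i hi => by simp [hv1 i hi], fun i => ?_, fun i => ?_⟩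
    · filter_upwards [hv2 i] with n h1
      convert neg_mem h1 using 1
      simp only [Finsupp.neg_apply, Prod.fst_neg, Prod.snd_neg]
      ring
    · convert neg_mem (hv3 i) using 1
      simp only [Finsupp.neg_apply, Prod.fst_neg, Prod.snd_neg, map_neg]
      ring

variable {S : Set W} {t : W → W → ℤ}

/-- Elements with integral coordinates and vanishing `z`-coordinates belong to the group. -/
theorem mem_ladderGroup_of_int {v : W →₀ LadderFiber} (h1 : ∀ i, (v i).1 = 0)
    (h2 : ∀ i, (v i).2.1 ∈ ratInt) (h3 : ∀ i, (v i).2.2.1 ∈ ratInt) : v ∈ ladderGroup S t := by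
  refine ⟨fun i _ => h1 i, fun i => .of_forall fun n => ?_, fun i => ?_⟩
  · simpa [h1 i] using h2 i
  · rw [ladderSum_eq_zero fun δ => by simp [h1 δ]]
    simpa using h3 i

/-- The subgroup of elements supported in `U`. -/
noncomputable def ladderStage (S : Set W) (t : W → W → ℤ) (U : Set W) : AddSubgroup (ladderGroup S t) where
  carrier := {v | ∀ i ∉ U, v.1 i = 0}
  add_mem' := fun ha hb i hi => by simp [ha i hi, hb i hi]
  zero_mem' := fun i _ => rfl
  neg_mem' := fun ha i hi => by simp [ha i hi]

theorem mem_ladderStage {U : Set W} {v : ladderGroup S t} :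
    v ∈ ladderStage S t U ↔ ∀ i ∉ U, v.1 i = 0 := Iff.rfl

/-- Evaluation at an index. -/
noncomputable def ladderEval (S : Set W) (t : W → W → ℤ) (i : W) : ladderGroup S t →+ LadderFiber :=
  (Finsupp.applyAddHom i).comp (ladderGroup S t).subtype

/-- The stage over a lower set whose complement contains no ladder that meets it in an infinite
set is a direct summand. -/
theorem exists_projection_ladderStage {U : Set W}
    (hout : ∀ i ∉ U, ∀ δ ∈ U, t δ i = 0)
    (hfin : ∀ δ ∉ U, {i | i ∈ U ∧ t δ i ≠ 0}.Finite) :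
    ∃ p : ladderGroup S t →+ ladderGroup S t,
      (∀ v, p v ∈ ladderStage S t U) ∧ ∀ v ∈ ladderStage S t U, p v = v := by
  classical
  -- Mere truncation to `U` would break the congruence for the `x`-coordinates, so the contribution
  -- of the discarded ladders is subtracted.
  let val (v : W →₀ LadderFiber) (i : W) : LadderFiber :=
    if i ∈ U then v i - (0, 0, ladderSum t i (v.filter (· ∉ U)), 0) else 0
  have hval_fin : ∀ v : W →₀ LadderFiber, (Function.support (val v)).Finite := by
    intro v
    refine (v.support.finite_toSet.union ((v.support.filter (· ∉ U)).finite_toSet.biUnion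
      fun δ hδ => hfin δ (Finset.mem_filter.1 hδ).2)).subset fun i hi => ?_
    have hiU : i ∈ U := by
      by_contra h
      exact hi (if_neg h)
    by_contra hcon
    simp only [Set.mem_union, not_or, Finset.mem_coe, Finsupp.mem_support_iff, not_not,
      Set.mem_iUnion, Finset.mem_filter, Set.mem_ofPred_eq, not_exists] at hcon
    refine hi ?_
    have h0 : ladderSum t i (v.filter (· ∉ U)) = 0 := by
      refine ladderSum_eq_zero fun δ => ?_
      by_cases hδ : δ ∈ U
      · simp [hδ]
      · rw [Finsupp.filter_apply_pos (fun i => i ∉ U) v hδ]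
        by_cases hv : v δ = 0
        · simp [hv]
        · have := hcon.2 δ ⟨hv, hδ⟩
          simp only [hiU, true_and, not_not] at this
          simp [this]
    simp [val, hiU, h0, hcon.1]
  let q (v : W →₀ LadderFiber) : W →₀ LadderFiber := Finsupp.ofSupportFinite (val v) (hval_fin v)
  have hq : ∀ v i, q v i = val v i := fun v i => rfl
  have hq_out : ∀ v, ∀ i ∉ U, q v i = 0 := fun v i hi => if_neg hi
  have hq_in : ∀ v, ∀ i ∈ U, q v i = v i - (0, 0, ladderSum t i (v.filter (· ∉ U)), 0) :=
    fun v i hi => if_pos hi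
  have hq_mem : ∀ v ∈ ladderGroup S t, q v ∈ ladderGroup S t := by
    rintro v ⟨h1, h2, h3⟩
    refine ⟨fun i hi => ?_, fun i => ?_, fun i => ?_⟩
    · by_cases hU : i ∈ U
      · simp [hq_in v i hU, h1 i hi]
      · simp [hq_out v i hU]
    · by_cases hU : i ∈ U
      · simpa [hq_in v i hU] using h2 i
      · simp [hq_out v i hU, zero_mem]
    · have hs : ladderSum t i (q v) = ladderSum t i (v.filter (· ∈ U)) := by
        refine ladderSum_congr fun δ => ?_
        by_cases hU : δ ∈ U
        · simp [hq_in v δ hU, hU]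
        · simp [hq_out v δ hU, hU]
      by_cases hU : i ∈ U
      · have hsplit : ladderSum t i v =
            ladderSum t i (v.filter (· ∈ U)) + ladderSum t i (v.filter (· ∉ U)) := by
          rw [← map_add, Finsupp.filter_add_filter_not]
        convert h3 i using 1
        rw [hs, hsplit, hq_in v i hU]
        simp only [Prod.snd_sub, Prod.fst_sub]
        ring
      · rw [hs, ladderSum_eq_zero fun δ => ?_]
        · simp [hq_out v i hU, zero_mem]
        · by_cases hδ : δ ∈ U
          · simp [hout i hU δ hδ]
          · simp [hδ]
  have hq_add : ∀ v w, q (v + w) = q v + q w := by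
    intro v w
    ext1 i
    rw [Finsupp.add_apply]
    by_cases hU : i ∈ U
    · rw [hq_in _ i hU, hq_in _ i hU, hq_in _ i hU, Finsupp.filter_add, map_add,
        Finsupp.add_apply]
      ext <;> simp
      ring
    · rw [hq_out _ i hU, hq_out _ i hU, hq_out _ i hU, add_zero]
  refine ⟨AddMonoidHom.mk' (fun v => ⟨q v, hq_mem v v.2⟩)
    fun v w => Subtype.ext (hq_add v w), fun v i hi => hq_out v i hi, fun v hv => ?_⟩
  refine Subtype.ext (Finsupp.ext fun i => ?_)
  change q v i = v.1 i
  by_cases hU : i ∈ U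
  · rw [hq_in _ i hU, ladderSum_eq_zero fun δ => ?_]
    · ext <;> simp
    · by_cases hδ : δ ∈ U
      · simp [hδ]
      · simp [Finsupp.filter_apply_pos (fun i => i ∉ U) v.1 hδ, hv δ hδ]
  · rw [hq_out _ i hU, hv i hU]

/-! ### The basic subgroup as the kernel of a map onto a direct sum of copies of `ℚ`. -/

/-- The homomorphism `z ↦ 1`, `y ↦ 0`, `x ↦ 0` on a fibre, which maps the free generator with index
`q` to `q`. -/
noncomputable def fiberHom : LadderFiber →+ ℚ :=
  AddMonoidHom.fst ℚ _ + (Finsupp.liftAddHom fun q : ℚ =>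
    (AddMonoidHom.mulRight q).comp (Int.castAddHom ℚ)).comp
      ((AddMonoidHom.snd ℚ _).comp ((AddMonoidHom.snd ℚ _).comp (AddMonoidHom.snd ℚ _)))

theorem fiberHom_of_snd_eq_zero {m : LadderFiber} (h : m.2.2.2 = 0) : fiberHom m = m.1 := by
  simp [fiberHom, h]

theorem fiberHom_single (q : ℚ) : fiberHom (0, 0, 0, Finsupp.single q 1) = q := by
  simp [fiberHom]

/-- The fibrewise application of `fiberHom`. -/
noncomputable def ladderCollapse (S : Set W) (t : W → W → ℤ) :
    ladderGroup S t →+ (W →₀ ℚ) :=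
  (Finsupp.mapRange.addMonoidHom fiberHom).comp (ladderGroup S t).subtype

theorem ladderCollapse_apply (v : ladderGroup S t) (i : W) :
    ladderCollapse S t v i = fiberHom (v.1 i) := rfl

/-- This is the purpose of the generators indexed by `ℚ`: they alone reach every rational value,
whatever the ladders are. -/
theorem ladderCollapse_surjective : Function.Surjective (ladderCollapse S t) := by
  classical
  intro w
  -- The value at `0` is set to `0`, since the generator with index `0` is not zero and finite
  -- support would be lost.
  let g : ℚ → LadderFiber := fun q => if q = 0 then 0 else (0, 0, 0, Finsupp.single q 1)
  have hg : ∀ q, (g q).1 = 0 ∧ (g q).2.1 = 0 ∧ (g q).2.2.1 = 0 := fun q => by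
    by_cases h : q = 0 <;> simp [g, h]
  refine ⟨⟨w.mapRange g (if_pos rfl), mem_ladderGroup_of_int (fun i => (hg _).1)
    (fun i => ?_) fun i => ?_⟩, Finsupp.ext fun i => ?_⟩
  · rw [Finsupp.mapRange_apply, (hg _).2.1]; exact zero_mem _
  · rw [Finsupp.mapRange_apply, (hg _).2.2]; exact zero_mem _
  · rw [ladderCollapse_apply, Finsupp.mapRange_apply]
    by_cases h : w i = 0
    · simp [g, h]
    · simp [g, h, fiberHom_single]

theorem exists_int_hom {A : Type*} [AddCommGroup A] (g : A →+ ℚ) (hg : ∀ x, g x ∈ ratInt) :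
    ∃ g' : A →+ ℤ, ∀ x, (g' x : ℚ) = g x := by
  choose g' hg' using fun x => mem_ratInt.1 (hg x)
  refine ⟨AddMonoidHom.mk' g' fun x y => ?_, hg'⟩
  have : ((g' (x + y) : ℤ) : ℚ) = ((g' x + g' y : ℤ) : ℚ) := by
    push_cast
    rw [hg', hg', hg', map_add]
  exact_mod_cast this

/-- A group of vectors in `LadderFiber` with integral coordinates is free. -/
theorem isFreeAb_of_fiber_int {A : Type*} [AddCommGroup A] (g : A →+ LadderFiber)
    (hinj : Function.Injective g) (h1 : ∀ x, (g x).1 ∈ ratInt) (h2 : ∀ x, (g x).2.1 ∈ ratInt)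
    (h3 : ∀ x, (g x).2.2.1 ∈ ratInt) : IsFreeAb A := by
  obtain ⟨g1, hg1⟩ := exists_int_hom ((AddMonoidHom.fst ℚ _).comp g) h1
  obtain ⟨g2, hg2⟩ := exists_int_hom
    (((AddMonoidHom.fst ℚ _).comp (AddMonoidHom.snd ℚ _)).comp g) h2
  obtain ⟨g3, hg3⟩ := exists_int_hom
    (((AddMonoidHom.fst ℚ _).comp ((AddMonoidHom.snd ℚ _).comp (AddMonoidHom.snd ℚ _))).comp g) h3
  let g4 : A →+ (ℚ →₀ ℤ) := ((AddMonoidHom.snd ℚ _).comp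
    ((AddMonoidHom.snd ℚ _).comp (AddMonoidHom.snd ℚ _))).comp g
  refine IsFreeAb.of_injective (g1.prod (g2.prod (g3.prod g4))) ?_ (Module.Free.prod ..)
  rw [injective_iff_map_eq_zero] at hinj ⊢
  intro x hx
  simp only [AddMonoidHom.prod_apply, Prod.mk_eq_zero] at hx
  refine hinj x (Prod.ext ?_ (Prod.ext ?_ (Prod.ext ?_ hx.2.2.2)))
  · exact (hg1 x).symm.trans (by rw [hx.1]; rfl)
  · exact (hg2 x).symm.trans (by rw [hx.2.1]; rfl)
  · exact (hg3 x).symm.trans (by rw [hx.2.2.1]; rfl)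

/-- The kernel of `ladderCollapse` is free. -/
theorem isFreeAb_ker_ladderCollapse : IsFreeAb (ladderCollapse S t).ker := by
  let B := (ladderCollapse S t).ker
  -- Split off the free coordinates. Where they vanish, `fiberHom` is the `z`-coordinate, so `z = 0`
  -- in `B` and the defining congruences make `y` and `x` integral.
  let f : B →+ (W →₀ (ℚ →₀ ℤ)) := (Finsupp.mapRange.addMonoidHom
    ((AddMonoidHom.snd ℚ _).comp ((AddMonoidHom.snd ℚ _).comp (AddMonoidHom.snd ℚ _)))).comp
      ((ladderGroup S t).subtype.comp B.subtype)
  have hf : ∀ v i, f v i = (v.1.1 i).2.2.2 := fun v i => rfl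
  refine isFreeAb_of_ker f ?_ (Module.Free.finsupp ..)
  have hker : ∀ v : f.ker, ∀ i, (v.1.1.1 i).2.2.2 = 0 := fun v i => by
    rw [← hf, v.2]; rfl
  have h1 : ∀ v : f.ker, ∀ i, (v.1.1.1 i).1 = 0 := fun v i => by
    rw [← fiberHom_of_snd_eq_zero (hker v i), ← ladderCollapse_apply, v.1.2]
    rfl
  have h2 : ∀ v : f.ker, ∀ i, (v.1.1.1 i).2.1 ∈ ratInt := fun v i => by
    obtain ⟨n, hn⟩ := (v.1.1.2.2.1 i).exists
    simpa [h1 v i] using hn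
  have h3 : ∀ v : f.ker, ∀ i, (v.1.1.1 i).2.2.1 ∈ ratInt := fun v i => by
    have := v.1.1.2.2.2 i
    rw [ladderSum_eq_zero fun δ => by simp [h1 v δ]] at this
    simpa using this
  let b : f.ker →+ (W →₀ ℚ × ℚ) := (Finsupp.mapRange.addMonoidHom
    (((AddMonoidHom.fst ℚ _).comp (AddMonoidHom.snd ℚ _)).prod
      ((AddMonoidHom.fst ℚ _).comp ((AddMonoidHom.snd ℚ _).comp (AddMonoidHom.snd ℚ _))))).comp
      (((ladderGroup S t).subtype.comp B.subtype).comp f.ker.subtype)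
  have hb : ∀ v i, b v i = ((v.1.1.1 i).2.1, (v.1.1.1 i).2.2.1) := fun v i => rfl
  let r : (W →₀ ℤ × ℤ) →+ (W →₀ ℚ × ℚ) := Finsupp.mapRange.addMonoidHom
    ((Int.castAddHom ℚ).prodMap (Int.castAddHom ℚ))
  have hr : Function.Injective r := Finsupp.mapRange_injective _ rfl
    (Prod.map_injective.2 ⟨Int.cast_injective, Int.cast_injective⟩)
  have hbr : ∀ v, b v ∈ r.range := by
    intro v
    choose k hk using fun i => mem_ratInt.1 (h2 v i)
    choose l hl using fun i => mem_ratInt.1 (h3 v i)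
    refine ⟨Finsupp.onFinset (b v).support (fun i => (k i, l i)) fun i hi => ?_,
      Finsupp.ext fun i => ?_⟩
    · rw [Finsupp.mem_support_iff, hb, ← hk, ← hl]
      intro h0
      simp only [Prod.mk_eq_zero, Int.cast_eq_zero] at h0
      exact hi (Prod.ext h0.1 h0.2)
    · rw [hb, ← hk, ← hl]
      rfl
  have hr_free : IsFreeAb r.range :=
    IsFreeAb.of_addEquiv (AddMonoidHom.ofInjective hr) (Module.Free.finsupp ..)
  refine hr_free.of_injective (b.codRestrict _ hbr) ?_
  rw [injective_iff_map_eq_zero]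
  intro v hv
  have hv' : b v = 0 := congrArg Subtype.val hv
  refine Subtype.ext (Subtype.ext (Subtype.ext (Finsupp.ext fun i => ?_)))
  have hbi := hb v i
  rw [hv'] at hbi
  have hbi' := Prod.ext_iff.1 hbi
  exact Prod.ext (h1 v i) (Prod.ext hbi'.1.symm (Prod.ext hbi'.2.symm (hker v i)))

/-- The kernel of `ladderCollapse` is a basic subgroup. -/
theorem isBasicSubgroup_ker_ladderCollapse : IsBasicSubgroup (ladderCollapse S t).ker where
  free := isFreeAb_ker_ladderCollapse
  pure := by
    intro n a ha
    by_cases hn : n = 0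
    · exact ⟨0, zero_mem _, by simp [hn]⟩
    -- The target of `ladderCollapse` is torsion-free, so `a` itself lies in the kernel.
    · refine ⟨a, ?_, rfl⟩
      rw [AddMonoidHom.mem_ker, map_zsmul] at ha
      exact (smul_eq_zero.1 ha).resolve_left hn
  divisible := by
    intro n hn q
    induction q using QuotientAddGroup.induction_on with
    | H v =>
      obtain ⟨w, hw⟩ := ladderCollapse_surjective (S := S) (t := t)
        ((n : ℚ)⁻¹ • ladderCollapse S t v)
      refine ⟨w, ?_⟩
      rw [← QuotientAddGroup.mk_zsmul, QuotientAddGroup.eq, AddMonoidHom.mem_ker, map_add,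
        map_neg, map_zsmul, hw, ← Int.cast_smul_eq_zsmul ℚ, smul_smul,
        mul_inv_cancel₀ (by exact_mod_cast hn), one_smul, neg_add_cancel]

end Ladder

/-! ### Bounded denominators, `ℵ₁`-freeness, and the bad quotients at `S`. -/

section Ladder

variable {W : Type*} {S : Set W} {t : W → W → ℤ}

/-- The elements of the group that are supported in a given finite set have bounded
denominators. -/
theorem exists_common_denominator [LinearOrder W] (ht : IsWeightSystem S t) (J : Finset W) :
    ∃ N : ℤ, N ≠ 0 ∧ ∀ v ∈ ladderGroup S t, (∀ i ∉ J, v i = 0) → ∀ i,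
      (N : ℚ) * (v i).1 ∈ ratInt ∧ (N : ℚ) * (v i).2.1 ∈ ratInt ∧
        (N : ℚ) * (v i).2.2.1 ∈ ratInt := by
  classical
  have hdisj : ∀ δ δ' : W, δ' ≠ δ → {i | t δ i ≠ 0 ∧ t δ' i ≠ 0}.Finite := by
    have key : ∀ δ δ' : W, δ' < δ → {i | t δ i ≠ 0 ∧ t δ' i ≠ 0}.Finite := fun δ δ' h =>
      (ht.finite_below δ δ' h).subset fun i hi => ⟨ht.lt_of_ne_zero δ' i hi.2, hi.1⟩
    intro δ δ' hne
    rcases hne.lt_or_gt with h | h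
    · exact key δ δ' h
    · exact (key δ' δ h).subset fun i hi => ⟨hi.2, hi.1⟩
  have hstep : ∀ δ, ∃ m : ℤ, m ≠ 0 ∧ ∀ v ∈ ladderGroup S t, (∀ i ∉ J, v i = 0) →
      (m : ℚ) * (v δ).1 ∈ ratInt := by
    intro δ
    by_cases hδ : δ ∈ S
    -- Almost disjointness leaves a rung `i` of `δ` outside `J` and off the other ladders from `J`.
    -- There the `x`-coordinate is zero and only `δ` contributes, so `t δ i` clears the denominator
    -- of the `z`-coordinate.
    · have hbad : ((J : Set W) ∪ ⋃ δ' ∈ J.erase δ, {i | t δ i ≠ 0 ∧ t δ' i ≠ 0}).Finite :=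
        J.finite_toSet.union ((J.erase δ).finite_toSet.biUnion fun δ' hδ' =>
          hdisj δ δ' (Finset.ne_of_mem_erase hδ'))
      obtain ⟨i, hi, hgood⟩ := ((ht.infinite δ hδ).sdiff hbad).nonempty
      simp only [Set.mem_union, not_or, Set.mem_iUnion, not_exists] at hgood
      refine ⟨t δ i, hi, fun v hv hJ => ?_⟩
      have h3 := hv.2.2 i
      rw [hJ i hgood.1, ladderSum_eq_single (δ := δ) fun δ' hne => ?_] at h3
      · have := neg_mem h3
        simpa [mul_comm] using this
      · by_cases hδ' : δ' ∈ J
        · by_cases h0 : t δ' i = 0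
          · simp [h0]
          · exact absurd ⟨hi, h0⟩ (hgood.2 δ' (Finset.mem_erase.2 ⟨hne, hδ'⟩))
        · simp [hJ δ' hδ']
    · refine ⟨1, one_ne_zero, fun v hv _ => ?_⟩
      rw [hv.1 δ hδ]
      simp [zero_mem]
  choose m hm0 hm using hstep
  refine ⟨∏ δ ∈ J, m δ, Finset.prod_ne_zero_iff.2 fun δ _ => hm0 δ, fun v hv hJ => ?_⟩
  set N := ∏ δ ∈ J, m δ with hN
  have h1 : ∀ i, (N : ℚ) * (v i).1 ∈ ratInt := by
    intro i
    by_cases hi : i ∈ J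
    · rw [hN, ← Finset.prod_erase_mul _ _ hi]
      push_cast
      rw [mul_assoc]
      exact_mod_cast intCast_mul_mem_ratInt (∏ x ∈ J.erase i, m x) (hm i v hv hJ)
    · rw [hJ i hi]
      simp [zero_mem]
  refine fun i => ⟨h1 i, ?_, ?_⟩
  · obtain ⟨n, hn⟩ := (hv.2.1 i).exists
    convert add_mem (intCast_mul_mem_ratInt N hn) (intCast_mul_mem_ratInt (adicSum n) (h1 i))
      using 1
    ring
  · have hsum : (N : ℚ) * ladderSum t i v ∈ ratInt := by
      rw [ladderSum_apply, Finset.mul_sum]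
      refine sum_mem fun δ _ => ?_
      convert intCast_mul_mem_ratInt (t δ i) (h1 δ) using 1
      ring
    convert add_mem (intCast_mul_mem_ratInt N (hv.2.2 i)) hsum using 1
    ring

theorem isAleph1Free_ladderGroup [LinearOrder W] (ht : IsWeightSystem S t) :
    IsAleph1Free (ladderGroup S t) := by
  classical
  intro H hH
  have hT : (⋃ v : H, (v.1.1.support : Set W)).Countable :=
    Set.countable_iUnion fun v => v.1.1.support.countable_toSet
  by_cases hne : (⋃ v : H, (v.1.1.support : Set W)).Nonempty
  swap
  · have hsub : Subsingleton H := by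
      refine subsingleton_of_forall_eq 0 fun v => Subtype.ext (Subtype.ext ?_)
      refine Finsupp.support_eq_empty.1 (Finset.eq_empty_of_forall_notMem fun i hi => hne ?_)
      exact ⟨i, Set.mem_iUnion.2 ⟨v, hi⟩⟩
    exact Module.Free.of_subsingleton ℤ H
  obtain ⟨s, hs⟩ := hT.exists_eq_range hne
  let P : ℕ → AddSubgroup H := fun n =>
    (ladderStage S t ((Finset.range n).image s)).comap H.subtype
  have hPmem : ∀ n (v : H), v ∈ P n ↔ ∀ i ∉ (Finset.range n).image s, v.1.1 i = 0 :=
    fun n v => Iff.rfl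
  have hmono : Monotone P := fun m n hmn v hv i hi =>
    hv i fun h => hi (Finset.image_subset_image (Finset.range_mono hmn) h)
  have hcov : ∀ v : H, ∃ n, v ∈ P n := by
    intro v
    have : ∀ i, ∃ n, i ∈ v.1.1.support → s n = i := by
      intro i
      by_cases hi : i ∈ v.1.1.support
      · have : i ∈ Set.range s := hs ▸ Set.mem_iUnion.2 ⟨v, hi⟩
        obtain ⟨n, hn⟩ := this
        exact ⟨n, fun _ => hn⟩
      · exact ⟨0, fun h => absurd h hi⟩
    choose r hr using this
    refine ⟨v.1.1.support.sup r + 1, fun i hi => ?_⟩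
    by_contra h0
    have hi' := Finsupp.mem_support_iff.2 h0
    exact hi (Finset.mem_coe.2 (Finset.mem_image.2
      ⟨r i, Finset.mem_range.2 (Nat.lt_succ_of_le (Finset.le_sup hi')), hr i hi'⟩))
  refine isFreeAb_of_chain P (fun n => P (n + 1)) (fun i j hij => hmono hij) ?_
    (fun v => (hcov v).imp fun n hn => hmono (Nat.le_succ n) hn) fun n => ?_
  · intro n v hv
    cases n with
    | zero => exact Or.inl (Subtype.ext (Subtype.ext (Finsupp.ext fun i => hv i (by simp))))
    | succ n => exact Or.inr ⟨n, Nat.lt_succ_self n, hv⟩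
  -- A repetition in the enumeration adds nothing, so the zero map serves.
  · by_cases hn : s n ∈ (Finset.range n).image s
    · have hPn : ∀ v ∈ P (n + 1), v ∈ P n := fun v hv i hi => hv i fun h => by
        rw [Finset.mem_coe, Finset.range_add_one, Finset.image_insert, Finset.mem_insert] at h
        rcases h with rfl | h
        · exact hi hn
        · exact hi h
      refine exists_free_complement (0 : H →+ ℤ) (fun _ _ => rfl) (fun v hv _ => hPn v hv)
        (isFreeAb_addSubgroup_int _)
    · refine exists_free_complement ((ladderEval S t (s n)).comp H.subtype)
        (fun v hv => hv _ hn) (fun v hv h0 i hi => ?_) ?_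
      · by_cases hin : i = s n
        · rw [hin]; exact h0
        · refine hv i fun h => ?_
          rw [Finset.mem_coe, Finset.range_add_one, Finset.image_insert, Finset.mem_insert] at h
          exact h.elim hin hi
      · obtain ⟨N, hN, hbd⟩ := exists_common_denominator ht ((Finset.range (n + 1)).image s)
        let M := (P (n + 1)).map ((ladderEval S t (s n)).comp H.subtype)
        have hval : ∀ m : M, (N : ℚ) * m.1.1 ∈ ratInt ∧ (N : ℚ) * m.1.2.1 ∈ ratInt ∧
            (N : ℚ) * m.1.2.2.1 ∈ ratInt := by
          rintro ⟨_, v, hv, rfl⟩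
          exact hbd v.1.1 v.1.2 hv (s n)
        refine isFreeAb_of_fiber_int ((zsmulAddGroupHom N).comp M.subtype) ?_ ?_ ?_ ?_
        · rw [injective_iff_map_eq_zero]
          intro m hm
          have hm' : N • (m : LadderFiber) = 0 := hm
          exact Subtype.ext ((smul_eq_zero.1 hm').resolve_left hN)
        · intro m
          have : N • m.1.1 ∈ ratInt := by rw [zsmul_eq_mul]; exact (hval m).1
          exact this
        · intro m
          have : N • m.1.2.1 ∈ ratInt := by rw [zsmul_eq_mul]; exact (hval m).2.1
          exact this
        · intro m
          have : N • m.1.2.2.1 ∈ ratInt := by rw [zsmul_eq_mul]; exact (hval m).2.2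
          exact this

/-- The partial sums along the ladder on `δ` are divisible by the moduli. -/
theorem exists_divisible_element [LinearOrder W] (ht : IsWeightSystem S t) {δ : W} (hδ : δ ∈ S)
    (n : ℕ) : ∃ w ∈ ladderGroup S t, 
      w δ = ((modulus n : ℚ)⁻¹, (adicSum n : ℚ) / modulus n, 0, 0) ∧
      ∀ i, δ < i → w i = 0 := by
  classical
  have hd : (modulus n : ℚ) ≠ 0 := by exact_mod_cast (modulus_pos n).ne'
  have htδ : ∀ i, δ ≤ i → t δ i = 0 := fun i hi => by
    by_contra h
    exact (ht.lt_of_ne_zero δ i h).not_ge hi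
  -- Only the finitely many rungs whose weight is not divisible by `modulus n` need a fractional
  -- `x`-coordinate.
  let c : W →₀ LadderFiber := Finsupp.onFinset (ht.finite_not_dvd δ n).toFinset
    (fun i => if modulus n ∣ t δ i then 0 else (0, 0, t δ i / modulus n, 0)) (by
      intro i hi
      rw [Set.Finite.mem_toFinset]
      exact fun h => hi (if_pos h))
  have hc : ∀ i, c i = if modulus n ∣ t δ i then 0 else (0, 0, (t δ i : ℚ) / modulus n, 0) :=
    fun i => rfl
  have hc1 : ∀ i, (c i).1 = 0 ∧ (c i).2.1 = 0 := fun i => by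
    rw [hc]
    split_ifs <;> simp
  have hcδ : ∀ i, δ ≤ i → c i = 0 := fun i hi => by
    rw [hc, if_pos (by simp [htδ i hi])]
  let m : LadderFiber := ((modulus n : ℚ)⁻¹, adicSum n / modulus n, 0, 0)
  have hs : ∀ i, ladderSum t i (Finsupp.single δ m + c) = t δ i / modulus n := fun i => by
    rw [map_add, ladderSum_single, ladderSum_eq_zero fun δ' => by simp [(hc1 δ').1], add_zero,
      div_eq_inv_mul]
  refine ⟨Finsupp.single δ m + c, ⟨fun i hi => ?_, fun i => ?_, fun i => ?_⟩, ?_, fun i hi => ?_⟩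
  · have : δ ≠ i := fun h => hi (h ▸ hδ)
    simp [this, (hc1 i).1]
  · by_cases hi : δ = i
    · subst hi
      filter_upwards [Filter.eventually_ge_atTop n] with k hk
      obtain ⟨z, hz⟩ := modulus_dvd_adicSum_sub hk
      refine ⟨-z, ?_⟩
      have hz' : (adicSum k : ℚ) - adicSum n = modulus n * z := by exact_mod_cast hz
      simp only [Finsupp.add_apply, Finsupp.single_eq_same, Prod.fst_add, Prod.snd_add, (hc1 δ).1,
        (hc1 δ).2, m, Int.coe_castAddHom, Int.cast_neg]
      field_simp
      linarith
    · simp [hi, (hc1 i).1, (hc1 i).2, zero_mem]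
  · rw [hs, Finsupp.add_apply, Prod.snd_add, Prod.snd_add, Prod.fst_add]
    have hm : ((Finsupp.single δ m) i).2.2.1 = 0 := by
      by_cases hi : δ = i
      · simp [hi, m]
      · simp [hi]
    rw [hm, zero_add, hc]
    by_cases h : modulus n ∣ t δ i
    · rw [if_pos h]
      obtain ⟨z, hz⟩ := h
      refine ⟨-z, ?_⟩
      rw [hz]
      simp [hd]
    · rw [if_neg h]
      simp [zero_mem]
  · simp [hcδ δ le_rfl, m]
  · rw [Finsupp.add_apply, hcδ i hi.le, Finsupp.single_apply, if_neg hi.ne, add_zero]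

/-- Homomorphisms to `ℤ` separate points of a free group, but on the countable subgroup generated by
the `x n` and `y` each of them kills `y`, by irrationality of `σ`. -/
theorem not_isAleph1Free_of_relations {A : Type*} [AddCommGroup A] (x : ℕ → A) {y : A}
    (hy : y ≠ 0) (hrel : ∀ n, modulus n • x n = x 0 + adicSum n • y) : ¬ IsAleph1Free A := by
  intro hfree
  let g : (ℕ →₀ ℤ) × ℤ →+ A :=
    ((Finsupp.linearCombination ℤ x).coprod (LinearMap.toSpanSingleton ℤ A y)).toAddMonoidHom
  have hgx : ∀ n, g (Finsupp.single n 1, 0) = x n := fun n => by simp [g]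
  have hgy : g (0, 1) = y := by simp [g]
  have hfr := hfree g.range (Set.countable_range g).to_subtype
  let X : ℕ → g.range := fun n => ⟨x n, _, hgx n⟩
  let Y : g.range := ⟨y, _, hgy⟩
  have hrel' : ∀ n, modulus n • X n = X 0 + adicSum n • Y := fun n => Subtype.ext (hrel n)
  have hY : Y = 0 := by
    refine (Module.forall_dual_apply_eq_zero_iff ℤ Y).1 fun φ => ?_
    by_contra h0
    obtain ⟨i, hi⟩ := exists_not_modulus_dvd (f := φ (X 0)) (g := φ Y) (Or.inr h0)
    refine hi ⟨φ (X i), ?_⟩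
    have := congrArg φ (hrel' i)
    rw [map_zsmul, map_add, map_zsmul, smul_eq_mul, smul_eq_mul] at this
    rw [this]
    ring
  exact hy (congrArg Subtype.val hY)

theorem not_isAleph1Free_quotient_of_relations {A : Type*} [AddCommGroup A] {P : AddSubgroup A}
    (x : ℕ → A) {y : A} (hy : y ∉ P)
    (hrel : ∀ n, modulus n • x n - (x 0 + adicSum n • y) ∈ P) : ¬ IsAleph1Free (A ⧸ P) :=
  not_isAleph1Free_of_relations (fun n => (x n : A ⧸ P)) (y := (y : A ⧸ P))
    (fun h => hy ((QuotientAddGroup.eq_zero_iff y).1 h))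
    fun n => sub_eq_zero.1 ((QuotientAddGroup.eq_zero_iff _).2 (hrel n))

/-- Modulo the stage below `δ` the rung corrections disappear, so the divisible elements satisfy the
relations exactly at coordinate `δ`; the element for `n = 0` plays the role of `z`. -/
theorem not_isAleph1Free_quotient [LinearOrder W] (ht : IsWeightSystem S t) {δ : W}
    (hδ : δ ∈ S) : ¬ IsAleph1Free (ladderGroup S t ⧸ ladderStage S t (Set.Iio δ)) := by
  classical
  intro hfree
  choose w hw hwδ hwi using exists_divisible_element ht hδ
  let y : ladderGroup S t := ⟨Finsupp.single δ (0, 1, 0, 0), by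
    have h : ∀ i, (Finsupp.single δ ((0, 1, 0, 0) : LadderFiber) i).1 = 0 ∧
        (Finsupp.single δ ((0, 1, 0, 0) : LadderFiber) i).2.1 ∈ ratInt ∧
        (Finsupp.single δ ((0, 1, 0, 0) : LadderFiber) i).2.2.1 ∈ ratInt := fun i => by
      by_cases hi : δ = i
      · subst hi
        simpa [zero_mem] using intCast_mem_ratInt 1
      · simp [hi, zero_mem]
    exact mem_ladderGroup_of_int (fun i => (h i).1) (fun i => (h i).2.1) fun i => (h i).2.2⟩
  refine not_isAleph1Free_quotient_of_relations (P := ladderStage S t (Set.Iio δ))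
    (fun n => ⟨w n, hw n⟩) (y := y) (fun h => ?_) (fun n => mem_ladderStage.2 fun i hi => ?_) hfree
  · have hy := h δ (lt_irrefl δ)
    simp [y] at hy
  have hi' : δ ≤ i := not_lt.1 hi
  change modulus n • w n i - (w 0 i + adicSum n • Finsupp.single δ (0, 1, 0, 0) i) = 0
  rcases hi'.eq_or_lt with rfl | h
  · have hd : (modulus n : ℚ) ≠ 0 := by exact_mod_cast (modulus_pos n).ne'
    have h0 : modulus 0 = 1 := rfl
    have h0' : adicSum 0 = 0 := rfl
    rw [hwδ, hwδ, h0, h0', Finsupp.single_eq_same]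
    refine Prod.ext ?_ (Prod.ext ?_ ?_)
    · simp [hd]
    · simp only [Prod.snd_sub, Prod.fst_sub, Prod.smul_snd, Prod.smul_fst, Prod.snd_add,
        Prod.fst_add, zsmul_eq_mul]
      field_simp
      simp
    · simp
  · rw [hwi n i h, hwi 0 i h, Finsupp.single_apply, if_neg h.ne]
    simp

end Ladder

/-! ### Projections, quotients of subgroups, and construction of weights. -/

section Ladder

/-- Groups of fibre vectors that meet the kernel of `fiberHom` trivially are `ℵ₁`-free. -/
theorem isAleph1Free_of_fiberHom {K : Type*} [AddCommGroup K] (g : K →+ LadderFiber)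
    (h0 : ∀ x, fiberHom (g x) = 0 → x = 0)
    (h2 : ∀ x, ∀ᶠ n in Filter.atTop, (g x).2.1 - (g x).1 * adicSum n ∈ ratInt)
    (h3 : ∀ x, (g x).2.2.1 ∈ ratInt) : IsAleph1Free K := by
  obtain ⟨g3, hg3⟩ := exists_int_hom
    (((AddMonoidHom.fst ℚ _).comp ((AddMonoidHom.snd ℚ _).comp (AddMonoidHom.snd ℚ _))).comp g) h3
  let g4 : K →+ (ℚ →₀ ℤ) := ((AddMonoidHom.snd ℚ _).comp
    ((AddMonoidHom.snd ℚ _).comp (AddMonoidHom.snd ℚ _))).comp g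
  -- After splitting off the integral `x` and free coordinates, elements are determined by `z`; the
  -- remaining group has rank at most one.
  refine .of_ker (g3.prod g4) ?_ (IsFreeAb.isAleph1Free (Module.Free.prod ..))
  have hker : ∀ x : (g3.prod g4).ker, (g x).2.2.2 = 0 := fun x => by
    have := x.2
    rw [AddMonoidHom.mem_ker, AddMonoidHom.prod_apply, Prod.mk_eq_zero] at this
    exact this.2
  have hfst : ∀ x : (g3.prod g4).ker, (g x).1 = 0 → x = 0 := fun x hx =>
    Subtype.ext (h0 _ ((fiberHom_of_snd_eq_zero (hker x)).trans hx))
  by_cases htriv : ∀ x : (g3.prod g4).ker, x = 0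
  · have : Subsingleton (g3.prod g4).ker := subsingleton_of_forall_eq 0 htriv
    exact IsFreeAb.isAleph1Free (Module.Free.of_subsingleton ℤ _)
  push Not at htriv
  obtain ⟨x₀, hx₀⟩ := htriv
  have ha : (g x₀).1 ≠ 0 := fun h => hx₀ (hfst x₀ h)
  obtain ⟨N, hN, hbd⟩ := exists_denominator_bound (b := (g x₀).2.1) ha
  -- Clearing the ratio of `z`-coordinates gives a combination with zero `z`-coordinate, hence zero;
  -- so the `y`-coordinates have the same ratio.
  have hprop : ∀ x : (g3.prod g4).ker, (g x).2.1 = (g x).1 / (g x₀).1 * (g x₀).2.1 := by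
    intro x
    set r := (g x).1 / (g x₀).1 with hr
    have hden : (r.den : ℚ) ≠ 0 := by exact_mod_cast r.den_nz
    have hrx : (r.den : ℚ) * (g x).1 = r.num * (g x₀).1 := by
      have h : (g x).1 = r * (g x₀).1 := by rw [hr, div_mul_cancel₀ _ ha]
      rw [h, ← mul_assoc, Rat.den_mul_eq_num]
    have hz : (r.den : ℤ) • x - r.num • x₀ = 0 := by
      refine hfst _ ?_
      simp only [AddSubgroup.coe_sub, AddSubgroup.coe_zsmul, map_sub, map_zsmul, Prod.fst_sub,
        Prod.smul_fst, zsmul_eq_mul, Int.cast_natCast]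
      linarith
    have hz' : (r.den : ℤ) • g x - r.num • g x₀ = 0 := by
      have := congrArg (fun y : (g3.prod g4).ker => g y) hz
      simpa only [AddSubgroup.coe_sub, AddSubgroup.coe_zsmul, map_sub, map_zsmul,
        AddSubgroup.coe_zero, map_zero] using this
    have h2 := congrArg (fun m : LadderFiber => m.2.1) hz'
    simp only [Prod.snd_sub, Prod.fst_sub, Prod.smul_snd, Prod.smul_fst, zsmul_eq_mul,
      Int.cast_natCast, Prod.snd_zero, Prod.fst_zero] at h2
    have h4 : (r.den : ℚ) * (g x).2.1 = r.den * (r * (g x₀).2.1) := by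
      rw [← mul_assoc, Rat.den_mul_eq_num]
      linarith
    exact mul_left_cancel₀ hden h4
  obtain ⟨k, hk⟩ := exists_int_hom ((AddMonoidHom.mulLeft ((N : ℚ) / (g x₀).1)).comp
    ((AddMonoidHom.fst ℚ _).comp (g.comp (g3.prod g4).ker.subtype))) fun x => by
      have := hbd ((g x).1 / (g x₀).1) ((h2 x).mono fun n hn => by
        rw [hprop x] at hn
        rwa [div_mul_cancel₀ _ ha])
      convert this using 1
      exact (div_mul_eq_mul_div _ _ _).trans (mul_div_assoc _ _ _)
  refine (IsFreeAb.isAleph1Free (Module.Free.self ℤ)).of_injective k ?_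
  rw [injective_iff_map_eq_zero]
  intro x hx
  have h := hk x
  rw [hx] at h
  have h' : (N : ℚ) / (g x₀).1 * (g x).1 = 0 := h.symm.trans Int.cast_zero
  refine hfst x ((mul_eq_zero.1 h').resolve_left (div_ne_zero ?_ ha))
  exact_mod_cast hN

variable {W : Type*} {S : Set W} {t : W → W → ℤ} [LinearOrder W]

/-- Ladders above `ν` meet the stage finitely; only a ladder on `ν` itself could obstruct, and `ν ∉
S` has none. -/
theorem exists_projection_Iio (ht : IsWeightSystem S t) {ν : W} (hν : ν ∉ S) :
    ∃ p : ladderGroup S t →+ ladderGroup S t, (∀ v, p v ∈ ladderStage S t (Set.Iio ν)) ∧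
      ∀ v ∈ ladderStage S t (Set.Iio ν), p v = v := by
  refine exists_projection_ladderStage (fun i hi δ hδ => ?_) fun δ hδ => ?_
  · by_contra h
    exact hi ((ht.lt_of_ne_zero δ i h).trans hδ)
  · rcases (not_lt.1 hδ : ν ≤ δ).eq_or_lt with rfl | h
    · simp [ht.eq_zero ν hν]
    · exact ht.finite_below δ ν h

/-- Including `ν` in the stage puts its ladder inside, so no condition on `ν` is needed. -/
theorem exists_projection_Iic (ht : IsWeightSystem S t) (ν : W) :
    ∃ p : ladderGroup S t →+ ladderGroup S t, (∀ v, p v ∈ ladderStage S t (Set.Iic ν)) ∧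
      ∀ v ∈ ladderStage S t (Set.Iic ν), p v = v := by
  refine exists_projection_ladderStage (fun i hi δ hδ => ?_) fun δ hδ => ?_
  · by_contra h
    exact hi ((ht.lt_of_ne_zero δ i h).le.trans hδ)
  · refine ((ht.finite_below δ ν (not_le.1 hδ)).insert ν).subset fun i hi => ?_
    rcases (hi.1 : i ≤ ν).eq_or_lt with rfl | h
    · exact Set.mem_insert _ _
    · exact Set.mem_insert_of_mem _ ⟨h, hi.2⟩

theorem isAleph1Free_quotient_Iio (ht : IsWeightSystem S t) {ν : W} (hν : ν ∉ S) :
    IsAleph1Free (ladderGroup S t ⧸ ladderStage S t (Set.Iio ν)) := by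
  obtain ⟨p, hp, hp'⟩ := exists_projection_Iio ht hν
  refine .quotient_of_hom (AddMonoidHom.id _ - p) (fun x => ?_) (isAleph1Free_ladderGroup ht)
  rw [AddMonoidHom.sub_apply, AddMonoidHom.id_apply, sub_eq_zero]
  exact ⟨fun h => h ▸ hp x, fun h => (hp' x h).symm⟩

variable {H : AddSubgroup (ladderGroup S t)}

theorem isAleph1Free_subgroup_quotient_of_notMem (ht : IsWeightSystem S t) {ν : W}
    (hν : ν ∉ S) : IsAleph1Free (H ⧸ (ladderStage S t (Set.Iio ν)).comap H.subtype) :=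
  (isAleph1Free_quotient_Iio ht hν).quotient_comap H

/-- Project away the summand up to `δ`: what is left is `ℵ₁`-free, and what is killed is seen at
coordinate `δ` as a group meeting the kernel of `fiberHom` trivially. -/
theorem isAleph1Free_subgroup_quotient_of_fiberHom (ht : IsWeightSystem S t) {δ : W}
    (hδ : ∀ v ∈ H, v ∈ ladderStage S t (Set.Iic δ) → fiberHom (v.1 δ) = 0 → v.1 δ = 0) :
    IsAleph1Free (H ⧸ (ladderStage S t (Set.Iio δ)).comap H.subtype) := by
  obtain ⟨p, hp, hp'⟩ := exists_projection_Iic ht δ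
  let f : H →+ ladderGroup S t := (AddMonoidHom.id _ - p).comp H.subtype
  have hf : ∀ v : H, f v = 0 ↔ (v : ladderGroup S t) ∈ ladderStage S t (Set.Iic δ) := fun v => by
    rw [AddMonoidHom.comp_apply, AddMonoidHom.sub_apply, AddMonoidHom.id_apply, sub_eq_zero]
    exact ⟨fun h => (show (v : ladderGroup S t) = p v from h) ▸ hp v, fun h => (hp' v h).symm⟩
  refine .quotient_of_hom_of_hom f ((ladderEval S t δ).comp H.subtype) (fun v => ?_)
    (isAleph1Free_ladderGroup ht) ?_
  · rw [hf]
    refine ⟨fun h i hi => ?_, fun h => ⟨fun i hi => h i fun hi' => hi (le_of_lt hi'),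
      h δ (lt_irrefl δ)⟩⟩
    rcases (not_lt.1 hi : δ ≤ i).eq_or_lt with rfl | h'
    · exact h.2
    · exact h.1 i (not_le.2 h')
  · refine isAleph1Free_of_fiberHom (AddSubgroup.subtype _) ?_ ?_ ?_ <;> rintro ⟨_, v, hv, rfl⟩
    · exact fun h => Subtype.ext (hδ v v.2 ((hf v).1 hv) h)
    · exact v.1.2.2.1 δ
    -- No ladder on an index up to `δ` has `δ` as a rung, so here the `x`-coordinate at `δ` is
    -- integral.
    · have h : (v.1.1 δ).2.2.1 - ladderSum t δ v.1.1 ∈ ratInt := v.1.2.2.2 δ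
      rwa [ladderSum_eq_zero, sub_zero] at h
      intro δ'
      by_cases h' : δ < δ'
      · rw [(hf v).1 hv δ' (not_le.2 h')]
        simp
      · have : t δ' δ = 0 := by
          by_contra hne
          exact h' (ht.lt_of_ne_zero δ' δ hne)
        simp [this]

/-- Two elements of `H` with equal codes at different places differ by an element of the kernel
of `ladderCollapse`. -/
theorem eq_of_code_eq (hH : H ⊓ (ladderCollapse S t).ker = ⊥) {δ δ' : W}
    {v w : ladderGroup S t} (hv : v ∈ H) (hw : w ∈ H)
    (hvδ : v ∈ ladderStage S t (Set.Iic δ)) (hwδ : w ∈ ladderStage S t (Set.Iic δ'))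
    (h0 : v.1 δ ≠ 0) (hφ : fiberHom (v.1 δ) = 0) (heq : v.1 δ = w.1 δ')
    (hlow : v.1.filter (· < δ) = w.1.filter (· < δ')) : δ = δ' := by
  classical
  have hdec : ∀ (δ : W) (v : ladderGroup S t), v ∈ ladderStage S t (Set.Iic δ) →
      v.1 = v.1.filter (· < δ) + Finsupp.single δ (v.1 δ) := by
    intro δ v hv
    ext1 i
    rw [Finsupp.add_apply]
    rcases lt_trichotomy i δ with h | rfl | h
    · simp [h, h.ne']
    · simp
    · simp [h.le, h.ne, hv i (not_le.2 h)]
  have hdiff : v.1 - w.1 = Finsupp.single δ (v.1 δ) - Finsupp.single δ' (v.1 δ) := by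
    conv_lhs => rw [hdec δ v hvδ, hdec δ' w hwδ, hlow, ← heq]
    abel
  have hmem : v - w ∈ H ⊓ (ladderCollapse S t).ker := by
    refine AddSubgroup.mem_inf.2 ⟨H.sub_mem hv hw, Finsupp.ext fun i => ?_⟩
    rw [ladderCollapse_apply, AddSubgroup.coe_sub, hdiff, Finsupp.sub_apply, map_sub]
    simp only [Finsupp.single_apply]
    split_ifs <;> simp [hφ]
  rw [hH, AddSubgroup.mem_bot, sub_eq_zero] at hmem
  by_contra hne
  have h := DFunLike.congr_fun hdiff δ
  rw [hmem, sub_self, Finsupp.sub_apply, Finsupp.single_eq_same, Finsupp.single_apply,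
    if_neg (Ne.symm hne), sub_zero] at h
  rw [hmem] at h0
  exact h0 h.symm

/-- Weights exist whenever `S` consists of limits of countable cofinality. -/
theorem exists_isWeightSystem (hcount : ∀ δ : W, (Set.Iio δ).Countable)
    (hlim : ∀ δ ∈ S, (Set.Iio δ).Nonempty ∧ ∀ i < δ, ∃ j < δ, i < j) :
    ∃ t : W → W → ℤ, IsWeightSystem S t := by
  classical
  have hladder : ∀ δ ∈ S, ∃ η : ℕ → W, StrictMono η ∧ (∀ n, η n < δ) ∧ ∀ i < δ, ∃ n, i < η n := by
    intro δ hδ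
    obtain ⟨hne, hnext⟩ := hlim δ hδ
    obtain ⟨s, hs⟩ := (hcount δ).exists_eq_range hne
    have hstep : ∀ i j : Set.Iio δ, ∃ k : Set.Iio δ, i < k ∧ j < k := fun i j => by
      obtain ⟨k, hk, hlt⟩ := hnext (max i j) (max_lt i.2 j.2)
      exact ⟨⟨k, hk⟩, (max_lt_iff.1 hlt).1, (max_lt_iff.1 hlt).2⟩
    choose f hf1 hf2 using hstep
    have hsδ : ∀ n, s n < δ := fun n => by
      have : s n ∈ Set.Iio δ := hs ▸ Set.mem_range_self n
      exact this
    -- Each rung passes the next element of an enumeration of the predecessors, so the ladder is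
    -- cofinal.
    let η : ℕ → Set.Iio δ := fun n => Nat.rec ⟨s 0, hsδ 0⟩ (fun n i => f i ⟨s n, hsδ n⟩) n
    refine ⟨fun n => (η n).1, strictMono_nat_of_lt_succ fun n => hf1 (η n) ⟨s n, hsδ n⟩,
      fun n => (η n).2, fun i hi => ?_⟩
    have hi' : i ∈ Set.Iio δ := hi
    rw [hs] at hi'
    obtain ⟨n, rfl⟩ := hi'
    exact ⟨n + 1, hf2 (η n) ⟨s n, hsδ n⟩⟩
  choose! η hmono hlt hcof using hladder
  -- The `n`-th rung gets weight `modulus n`; as the moduli form a divisor chain, only rungs before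
  -- the `n`-th can fail divisibility by `modulus n`.
  let t : W → W → ℤ := fun δ i => if δ ∈ S then Function.extend (η δ) modulus 0 i else 0
  have htη : ∀ δ ∈ S, ∀ n, t δ (η δ n) = modulus n := fun δ hδ n => by
    simp only [t, if_pos hδ]
    exact (hmono δ hδ).injective.extend_apply _ _ n
  have htne : ∀ δ i, t δ i ≠ 0 → δ ∈ S ∧ ∃ n, η δ n = i := by
    intro δ i h
    by_cases hδ : δ ∈ S
    · refine ⟨hδ, ?_⟩
      by_contra hcon
      refine h ?_
      simp only [t, if_pos hδ]
      exact Function.extend_apply' _ _ _ hcon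
    · exact absurd (if_neg hδ) h
  refine ⟨t, ⟨fun δ i h => ?_, fun δ hδ i => if_neg hδ, fun δ ν hν => ?_, fun δ hδ => ?_,
    fun δ n => ?_⟩⟩
  · obtain ⟨hδ, n, rfl⟩ := htne δ i h
    exact hlt δ hδ n
  · by_cases hδ : δ ∈ S
    · obtain ⟨n, hn⟩ := hcof δ hδ ν hν
      refine ((Set.finite_lt_nat n).image (η δ)).subset ?_
      rintro i ⟨hi, hne⟩
      obtain ⟨-, m, rfl⟩ := htne δ i hne
      exact ⟨m, (hmono δ hδ).lt_iff_lt.1 (hi.trans hn), rfl⟩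
    · convert Set.finite_empty
      ext i
      simp [t, hδ]
  · refine (Set.infinite_range_of_injective (hmono δ hδ).injective).mono ?_
    rintro _ ⟨n, rfl⟩
    change t δ (η δ n) ≠ 0
    rw [htη δ hδ]
    exact (modulus_pos n).ne'
  · refine ((Set.finite_lt_nat n).image (η δ)).subset fun i hi => ?_
    have hne : t δ i ≠ 0 := fun h => hi (h ▸ dvd_zero _)
    obtain ⟨hδ, m, rfl⟩ := htne δ i hne
    refine ⟨m, ?_, rfl⟩
    by_contra hm
    refine hi ?_
    rw [htη δ hδ]
    exact modulus_dvd (not_lt.1 hm)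

end Ladder

/-! ### The filtration by stages, freeness of disjoint subgroups, and separability. -/

section Ladder

variable {W : Type*} {S : Set W} {t : W → W → ℤ}

theorem countable_setOf_support_subset {U : Set W} (hU : U.Countable) :
    {v : W →₀ LadderFiber | ∀ i ∉ U, v i = 0}.Countable := by
  classical
  have := hU.to_subtype
  refine Set.MapsTo.countable_of_injOn (t := Set.univ)
    (f := fun v : W →₀ LadderFiber => v.subtypeDomain (· ∈ U)) (fun _ _ => trivial) ?_
    Set.countable_univ
  intro v hv w hw hvw
  ext1 i
  by_cases hi : i ∈ U
  · exact DFunLike.congr_fun hvw ⟨i, hi⟩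
  · rw [hv i hi, hw i hi]

theorem countable_ladderStage {U : Set W} (hU : U.Countable) : Countable (ladderStage S t U) := by
  have := (countable_setOf_support_subset hU).to_subtype
  refine Function.Injective.countable
    (f := fun v : ladderStage S t U => (⟨v.1.1, v.2⟩ : {v : W →₀ LadderFiber | ∀ i ∉ U, v i = 0}))
    fun v w hvw => ?_
  have h : v.1.1 = w.1.1 := Subtype.mk.inj hvw
  exact Subtype.ext (Subtype.ext h)

variable [LinearOrder W]

theorem countable_Iio_of_orderIso (e : CountableOrdinal ≃o W) (w : W) : (Set.Iio w).Countable := by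
  refine ((CountableOrdinal.countable_Iio (e.symm w)).image e).mono fun i hi => ?_
  exact ⟨e.symm i, e.symm.lt_iff_lt.2 hi, e.apply_symm_apply i⟩

theorem isSuccLimit_orderIso_apply {α β : Type*} [LinearOrder α] [LinearOrder β] (e : α ≃o β)
    {a : α} : Order.IsSuccLimit (e a) ↔ Order.IsSuccLimit a :=
  InitialSeg.isSuccLimit_apply_iff (e.toRelIsoLT.toInitialSeg)

/-- A finite set of elements below a limit is bounded below the limit. -/
theorem exists_bound_of_isSuccLimit {ν : W} (hν : Order.IsSuccLimit ν) (J : Finset W)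
    (hJ : ∀ i ∈ J, i < ν) : ∃ μ < ν, ∀ i ∈ J, i < μ := by
  classical
  induction J using Finset.induction_on with
  | empty =>
    obtain ⟨μ, hμ⟩ := not_isMin_iff.1 hν.1
    exact ⟨μ, hμ, by simp⟩
  | insert a J _ ih =>
    obtain ⟨μ, hμ, h⟩ := ih fun i hi => hJ i (Finset.mem_insert_of_mem hi)
    obtain ⟨κ, hκ, hlt⟩ := hν.2.lt_iff_exists_lt.1 (max_lt hμ (hJ a (Finset.mem_insert_self _ _)))
    refine ⟨κ, hκ, fun i hi => ?_⟩
    rcases Finset.mem_insert.1 hi with rfl | hi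
    · exact (le_max_right _ _).trans_lt hlt
    · exact (h i hi).trans ((le_max_left _ _).trans_lt hlt)

theorem isOmega1Filtration_ladderStage (e : CountableOrdinal ≃o W) :
    IsOmega1Filtration fun ν => ladderStage S t (Set.Iio (e ν)) where
  countable ν := countable_ladderStage (countable_Iio_of_orderIso e _)
  mono μ ν h v hv i hi := hv i fun hi' => hi (hi'.trans_le (e.monotone h))
  continuous ν hν v hv := by
    obtain ⟨μ, hμ, h⟩ := exists_bound_of_isSuccLimit ((isSuccLimit_orderIso_apply e).2 hν)
      v.1.support fun i hi => by
        by_contra hi'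
        exact Finsupp.mem_support_iff.1 hi (hv i hi')
    refine ⟨e.symm μ, e.lt_iff_lt.1 (by simpa using hμ), fun i hi => ?_⟩
    by_contra h0
    exact hi (by simpa using h i (Finsupp.mem_support_iff.2 h0))
  exhaustive v := by
    obtain ⟨ν, hν⟩ := CountableOrdinal.exists_gt_of_countable
      (v.1.support.countable_toSet.image e.symm)
    refine ⟨ν, fun i hi => ?_⟩
    by_contra h0
    refine hi ?_
    have := hν _ ⟨i, Finsupp.mem_support_iff.2 h0, rfl⟩
    rwa [OrderIso.symm_apply_lt] at this

theorem IsOmega1Filtration.comap {A : Type*} [AddCommGroup A]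
    {F : CountableOrdinal → AddSubgroup A} (hF : IsOmega1Filtration F) (H : AddSubgroup A) :
    IsOmega1Filtration fun ν => (F ν).comap H.subtype where
  countable ν := by
    have := hF.countable ν
    refine Function.Injective.countable (f := fun v : (F ν).comap H.subtype => (⟨v.1.1, v.2⟩ : F ν))
      fun v w hvw => ?_
    have h : v.1.1 = w.1.1 := Subtype.mk.inj hvw
    exact Subtype.ext (Subtype.ext h)
  mono μ ν h v hv := hF.mono h hv
  continuous ν hν v hv := hF.continuous ν hν v hv
  exhaustive v := hF.exhaustive v

/-- Subgroups that meet the kernel of `ladderCollapse` trivially are free. -/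
theorem isFreeAb_of_inf_ker_eq_bot (e : CountableOrdinal ≃o W) (ht : IsWeightSystem S t)
    (hS : ∀ δ ∈ S, Order.IsSuccLimit δ) {H : AddSubgroup (ladderGroup S t)}
    (hH : H ⊓ (ladderCollapse S t).ker = ⊥) : IsFreeAb H := by
  classical
  refine ((isOmega1Filtration_ladderStage e).comap H).isFreeAb
    ((isAleph1Free_ladderGroup ht).of_injective H.subtype H.subtype_injective) fun hstat => ?_
  let E : Set CountableOrdinal := {ν | e ν ∈ S ∧ ∃ v ∈ H, v ∈ ladderStage S t (Set.Iic (e ν)) ∧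
    fiberHom (v.1 (e ν)) = 0 ∧ v.1 (e ν) ≠ 0}
  have hsub : {ν | ¬ IsAleph1Free (H ⧸ (ladderStage S t (Set.Iio (e ν))).comap H.subtype)} ⊆ E := by
    intro ν hν
    by_contra hE
    refine hν ?_
    by_cases hνS : e ν ∈ S
    · refine isAleph1Free_subgroup_quotient_of_fiberHom ht fun v hv hvν h0 => ?_
      by_contra hne
      exact hE ⟨hνS, v, hv, hvν, h0, hne⟩
    · exact isAleph1Free_subgroup_quotient_of_notMem ht hνS
  have hE : ∀ ν, ∃ v : ladderGroup S t, ν ∈ E → v ∈ H ∧ v ∈ ladderStage S t (Set.Iic (e ν)) ∧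
      fiberHom (v.1 (e ν)) = 0 ∧ v.1 (e ν) ≠ 0 := by
    intro ν
    by_cases hν : ν ∈ E
    · obtain ⟨-, v, hv⟩ := hν
      exact ⟨v, fun _ => hv⟩
    · exact ⟨0, fun h => absurd h hν⟩
  choose v hv using hE
  -- The code of a bad `ν` is its witness's top value and lower part. The finite lower part is
  -- bounded below the limit `ν` and the fibre is countable, so the code already occurs in a
  -- countable set attached to some `μ < ν`.
  refine CountableOrdinal.not_isStationary_of_injOn (E := E)
    (fun ν => ((v ν).1 (e ν), (v ν).1.filter (· < e ν))) ?_
    (fun μ => Set.univ ×ˢ {w | ∀ i ∉ Set.Iio (e μ), w i = 0}) (fun μ => ?_) (fun ν hν => ?_)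
    (hstat.mono hsub)
  · intro μ hμ ν hν hμν
    obtain ⟨h1, h2, h3, h4⟩ := hv μ hμ
    obtain ⟨k1, k2, -, -⟩ := hv ν hν
    rw [Prod.mk.injEq] at hμν
    exact e.injective (eq_of_code_eq hH h1 k1 h2 k2 h4 h3 hμν.1 hμν.2)
  · exact Set.countable_univ.prod
      (countable_setOf_support_subset (countable_Iio_of_orderIso e (e μ)))
  · obtain ⟨μ, hμ, h⟩ := exists_bound_of_isSuccLimit (hS _ hν.1)
      ((v ν).1.filter (· < e ν)).support fun i hi => by
        rw [Finsupp.support_filter] at hi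
        exact (Finset.mem_filter.1 hi).2
    refine ⟨e.symm μ, e.lt_iff_lt.1 (by simpa using hμ), trivial, fun i hi => ?_⟩
    by_contra h0
    exact hi (by simpa using h i (Finsupp.mem_support_iff.2 h0))

theorem isAleph1Separable_ladderGroup (e : CountableOrdinal ≃o W) (ht : IsWeightSystem S t) :
    IsAleph1Separable (ladderGroup S t) := by
  intro X hX
  obtain ⟨ν, hν⟩ := (isOmega1Filtration_ladderStage (S := S) (t := t) e).exists_le hX
  obtain ⟨p, hp, hp'⟩ := exists_projection_Iic ht (e ν)
  have hcount : Countable (ladderStage S t (Set.Iic (e ν))) := by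
    refine countable_ladderStage ?_
    rw [← Set.Iio_insert]
    exact (countable_Iio_of_orderIso e _).insert _
  refine ⟨ladderStage S t (Set.Iic (e ν)), fun v hv i hi => hν hv i fun h => hi (le_of_lt h),
    hcount, isAleph1Free_ladderGroup ht _ hcount, p.ker, ?_, ?_⟩
  · rw [AddSubgroup.disjoint_def]
    exact fun {v} hv h => (hp' v hv).symm.trans h
  · rw [codisjoint_iff, eq_top_iff]
    intro v _
    rw [AddSubgroup.mem_sup]
    refine ⟨p v, hp v, v - p v, ?_, add_sub_cancel _ _⟩
    rw [AddMonoidHom.mem_ker, map_sub, hp' _ (hp v), sub_self]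

end Ladder

/-! ### Cardinality, rank, the Gamma invariant, and the conclusion. -/

theorem aleph_one_le_mk_iff {α : Type*} : ℵ₁ ≤ #α ↔ Uncountable α := by
  rw [← Cardinal.succ_aleph0, Order.succ_le_iff, Cardinal.aleph0_lt_mk_iff]

theorem cardinalMk_ladderGroup {W : Type} (hW : #W = ℵ₁) {S : Set W} {t : W → W → ℤ} :
    #(ladderGroup S t) ≤ ℵ₁ := by
  have hne : Infinite W := by
    rw [Cardinal.infinite_iff, hW]
    exact Cardinal.aleph0_lt_aleph_one.le
  refine (Cardinal.mk_subtype_le _).trans ?_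
  rw [Cardinal.mk_finsupp_of_infinite, hW]
  exact max_le le_rfl (Cardinal.mk_le_aleph0.trans Cardinal.aleph0_lt_aleph_one.le)

theorem uncountable_ker_ladderCollapse {W : Type} (hW : #W = ℵ₁) {S : Set W} {t : W → W → ℤ} :
    Uncountable (ladderCollapse S t).ker := by
  classical
  have hmem : ∀ j, Finsupp.single j ((0, 1, 0, 0) : LadderFiber) ∈ ladderGroup S t := by
    intro j
    have h : ∀ i, (Finsupp.single j ((0, 1, 0, 0) : LadderFiber) i).1 = 0 ∧
        (Finsupp.single j ((0, 1, 0, 0) : LadderFiber) i).2.1 ∈ ratInt ∧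
        (Finsupp.single j ((0, 1, 0, 0) : LadderFiber) i).2.2.1 ∈ ratInt := fun i => by
      by_cases hi : j = i
      · subst hi
        simpa [zero_mem] using intCast_mem_ratInt 1
      · simp [hi, zero_mem]
    exact mem_ladderGroup_of_int (fun i => (h i).1) (fun i => (h i).2.1) fun i => (h i).2.2
  have hker : ∀ j, (⟨_, hmem j⟩ : ladderGroup S t) ∈ (ladderCollapse S t).ker := by
    intro j
    refine Finsupp.ext fun i => ?_
    rw [ladderCollapse_apply]
    simp only [Finsupp.single_apply]
    split_ifs <;> simp [fiberHom]
  have hWu : Uncountable W := by rw [← aleph_one_le_mk_iff, hW]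
  refine Function.Injective.uncountable (f := fun j => (⟨_, hker j⟩ : (ladderCollapse S t).ker))
    fun i j hij => ?_
  exact Finsupp.single_left_injective (b := ((0, 1, 0, 0) : LadderFiber)) (by simp)
    (congrArg (fun v => v.1.1) hij)

/-- A free abelian group of size `ℵ₁` has rank `ℵ₁`. -/
theorem IsFreeAb.rank_eq_aleph_one {A : Type} [AddCommGroup A] (h : IsFreeAb A)
    (hle : #A ≤ ℵ₁) [Uncountable A] : Module.rank ℤ A = ℵ₁ := by
  have := h
  refine le_antisymm ((rank_le_card ℤ A).trans hle) ?_
  rw [Module.Free.rank_eq_card_chooseBasisIndex, aleph_one_le_mk_iff]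
  by_contra hι
  have := not_uncountable_iff.1 hι
  exact not_countable (Module.Free.chooseBasis ℤ A).repr.injective.countable

theorem IsBasicSubgroup.rank_eq_aleph_one {A : Type} [AddCommGroup A] {B : AddSubgroup A}
    (hB : IsBasicSubgroup B) (hle : #A ≤ ℵ₁) (hB' : Uncountable B) : Module.rank ℤ B = ℵ₁ :=
  hB.free.rank_eq_aleph_one ((Cardinal.mk_subtype_le _).trans hle)

theorem not_isStationary_ladderGroup_of_isFreeAb {W : Type*} [LinearOrder W]
    (e : CountableOrdinal ≃o W) {S : Set W} {t : W → W → ℤ} (ht : IsWeightSystem S t)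
    (h : IsFreeAb (ladderGroup S t)) : ¬ IsStationary (e ⁻¹' S) := fun hstat => by
  have key := (isOmega1Filtration_ladderStage (S := S) (t := t) e).not_isStationary_of_isFreeAb h
  refine key (hstat.mono fun ν hν => ?_)
  exact not_isAleph1Free_quotient ht hν

theorem isIrwinCounterexample_ladderGroup {W : Type} [LinearOrder W] (e : CountableOrdinal ≃o W)
    (hW : #W = ℵ₁) {S : Set W} {t : W → W → ℤ} (ht : IsWeightSystem S t)
    (hS : ∀ δ ∈ S, Order.IsSuccLimit δ) (hstat : IsStationary (e ⁻¹' S)) :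
    IsIrwinCounterexample (ladderGroup S t) (ladderCollapse S t).ker where
  torsionFree := inferInstance
  card_eq := by
    have := uncountable_ker_ladderCollapse hW (S := S) (t := t)
    refine le_antisymm (cardinalMk_ladderGroup hW) ((aleph_one_le_mk_iff.2 this).trans
      (Cardinal.mk_subtype_le (α := ladderGroup S t) (· ∈ (ladderCollapse S t).ker)))
  separable := isAleph1Separable_ladderGroup e ht
  basic := isBasicSubgroup_ker_ladderCollapse
  rank_eq := isBasicSubgroup_ker_ladderCollapse.rank_eq_aleph_one (cardinalMk_ladderGroup hW)
    (uncountable_ker_ladderCollapse hW)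
  free_of_disjoint H hH := isFreeAb_of_inf_ker_eq_bot e ht hS hH
  not_free h := not_isStationary_ladderGroup_of_isFreeAb e ht h hstat

theorem PowModNS.mk_eq_zero {s : Set CountableOrdinal} (h : ¬ IsStationary s) :
    PowModNS.mk s = 0 :=
  Quotient.sound (s := nonstationarySetoid) (show ¬ IsStationary (symmDiff s ∅) by
    rwa [← Set.bot_eq_empty, symmDiff_bot])

/-- Any filtration agrees with the stages on a club, where the bad quotients are exactly those at
`S`; passing from `S₀` to its limit points costs only a nonstationary set. -/
theorem hasGammaInvariant_ladderGroup {W : Type} [LinearOrder W] (e : CountableOrdinal ≃o W)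
    {S : Set W} {t : W → W → ℤ} (ht : IsWeightSystem S t) {S₀ : Set CountableOrdinal}
    (hS₀ : ∀ ν, e ν ∈ S ↔ ν ∈ S₀ ∧ Order.IsSuccLimit ν) :
    HasGammaInvariant (ladderGroup S t) (PowModNS.mk S₀) := by
  refine ⟨⟨_, isOmega1Filtration_ladderStage e⟩, fun F hF => ?_⟩
  obtain ⟨C, hC, hFC⟩ := hF.exists_isClub_eq (isOmega1Filtration_ladderStage e)
  refine Quotient.sound (s := nonstationarySetoid) (not_isStationary_iff.2
    ⟨_, hC.inter cof_countableOrdinal_ne (CountableOrdinal.isClub_closed id), ?_⟩)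
  refine Set.disjoint_right.2 fun ν hν hmem => ?_
  have hiff : ν ∈ {ν | ¬ IsAleph1Free (ladderGroup S t ⧸ F ν)} ↔ ν ∈ S₀ := by
    change ¬ IsAleph1Free (ladderGroup S t ⧸ F ν) ↔ _
    rw [hFC ν hν.1]
    refine ⟨fun h => ?_, fun h => not_isAleph1Free_quotient ht ((hS₀ ν).2 ⟨h, hν.2.1⟩)⟩
    by_contra hν0
    exact h (isAleph1Free_quotient_Iio ht fun h' => hν0 ((hS₀ ν).1 h').1)
  rcases hmem with h | h
  · exact h.2 (hiff.1 h.1)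
  · exact h.2 (hiff.2 h.1)

theorem exists_isIrwinCounterexample {γ : PowModNS} (hγ : γ ≠ 0) :
    ∃ (G : Type) (_ : AddCommGroup G) (B : AddSubgroup G),
      IsIrwinCounterexample G B ∧ HasGammaInvariant G γ := by
  obtain ⟨S₀, rfl⟩ : ∃ S₀, PowModNS.mk S₀ = γ := Quotient.exists_rep γ
  -- `CountableOrdinal` lives in `Type 1`; its copy in `Type` is needed as index set for `G : Type`.
  let e : CountableOrdinal ≃o (ω₁ : Ordinal.{0}).ToType := Ordinal.ToType.mk
  let S : Set (ω₁ : Ordinal.{0}).ToType := {w | e.symm w ∈ S₀ ∧ Order.IsSuccLimit w}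
  have hS₀ : ∀ ν, e ν ∈ S ↔ ν ∈ S₀ ∧ Order.IsSuccLimit ν := fun ν => by
    change e.symm (e ν) ∈ S₀ ∧ Order.IsSuccLimit (e ν) ↔ _
    rw [e.symm_apply_apply, isSuccLimit_orderIso_apply]
  have hlim : ∀ δ ∈ S, Order.IsSuccLimit δ := fun δ hδ => hδ.2
  have hstat : IsStationary (e ⁻¹' S) := by
    intro C hC
    have h0 : IsStationary S₀ := by
      by_contra h
      exact hγ (PowModNS.mk_eq_zero h)
    obtain ⟨ν, hν, hνC⟩ := h0 (hC.inter cof_countableOrdinal_ne (CountableOrdinal.isClub_closed id))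
    exact ⟨ν, (hS₀ ν).2 ⟨hν, hνC.2.1⟩, hνC.1⟩
  obtain ⟨t, ht⟩ := exists_isWeightSystem (S := S) (countable_Iio_of_orderIso e) fun δ hδ =>
    ⟨not_isMin_iff.1 (hlim δ hδ).1, fun i hi => (hlim δ hδ).2.lt_iff_exists_lt.1 hi⟩
  have hW : #(ω₁ : Ordinal.{0}).ToType = ℵ₁ := by simp
  exact ⟨ladderGroup S t, inferInstance, (ladderCollapse S t).ker,
    isIrwinCounterexample_ladderGroup e hW ht hlim hstat, hasGammaInvariant_ladderGroup e ht hS₀⟩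

theorem theorem3 :
    (∃ (G : Type) (_ : AddCommGroup G) (B : AddSubgroup G), IsIrwinCounterexample G B) ∧
    (∀ γ : PowModNS, γ ≠ 0 →
      ∃ (G : Type) (_ : AddCommGroup G) (B : AddSubgroup G),
        IsIrwinCounterexample G B ∧ HasGammaInvariant G γ) ∧
    ¬ (∀ (G : Type) [AddCommGroup G], IsAddTorsionFree G →
        (∃ B : AddSubgroup G, IsBasicSubgroup B ∧ ℵ₀ ≤ Module.rank ℤ B ∧
          ∀ H : AddSubgroup G, H ⊓ B = ⊥ → IsFreeAb H) →
        IsFreeAb G) := by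
  have hne : PowModNS.mk Set.univ ≠ 0 := by
    intro h
    have h' : ¬ IsStationary (symmDiff Set.univ (∅ : Set CountableOrdinal)) :=
      Quotient.exact (s := nonstationarySetoid) h
    rw [← Set.bot_eq_empty, symmDiff_bot] at h'
    exact h' .univ
  obtain ⟨G, hG, B, hB, -⟩ := exists_isIrwinCounterexample hne
  refine ⟨⟨G, hG, B, hB⟩, fun γ hγ => exists_isIrwinCounterexample hγ, fun hall => ?_⟩
  refine hB.not_free (hall G hB.torsionFree ⟨B, hB.basic, ?_, hB.free_of_disjoint⟩)
  rw [hB.rank_eq]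
  exact Cardinal.aleph0_lt_aleph_one.le
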